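/- **Theorem.** Let $d\ge 1$ and let $x\sim y$ denote nearest neighbors in $\mathbb Z^d$ ($\|x-y\|=1$). Let $\rho^+,\rho^-\ge 0$ with $\rho^++\rho^-\le 1$. Independently for each $x\in\mathbb Z^d$, declare $x$ *frozen plus*, *frozen minus* or *unfrozen* with respective probabilities $\rho^+$, $\rho^-$ and $1-\rho^+-\rho^-$. Independently of this, give the vertices independent rate $1$ Poisson clocks, and attach to every clock ring an independent fair coin. Let $\mathbb P$ be the resulting probability measure. Given an initial configuration $\sigma'(0)\in\{-1,+1\}^{\mathbb Z^d}$, the spins $\sigma'_x(t)\in\{-1,+1\}$ evolve as follows. Frozen plus (minus) vertices have spin $+1$ ($-1$) at all times. An unfrozen vertex $x$ starts from its prescribed value $\sigma'_x(0)$, and its spin can change only when its clock rings. At a ring, its spin becomes the value taken just before the ring by the strict majority of its $2d$ nearest neighbors; in case of a tie, it becomes $+1$ or $-1$ according to the coin of that ring. The processes for all $\sigma'(0)$ are thus coupled on one probability space. Call $x$ *fixed minus* if $\sigma'_x(t)=-1$ for all sufficiently large $t$, and a *flipper* if $\sigma'_x$ changes sign at arbitrarily large times. Let $\mathcal C(\sigma'(0))$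 be the set of all fixed minus vertices and flippers. For every $d\ge 1$ and every $\rho^+>0$ there is $\varepsilon=\varepsilon(d,\rho^+)>0$ such that for every $\rho^-$ with $0<\rho^-<\varepsilon$ and $\rho^++\rho^-\le 1$, the following holds. $\mathbb P$-almost surely, simultaneously for every $\sigma'(0)\in\{-1,+1\}^{\mathbb Z^d}$, the dynamics started from $\sigma'(0)$ has a trajectory, and for every such trajectory the subgraph of the nearest-neighbor lattice induced by $\mathcal C(\sigma'(0))$ has no infinite connected component. In particular, $$\mathbb P\big(\mathcal C(\sigma'(0))\text{ contains an infinite component for some }\sigma'(0)\big)=0 .$$ -/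

import Mathlib

open MeasureTheory ProbabilityTheory Filter Topology
open scoped NNReal ENNReal

namespace FrozenMajority

/-! ### The lattice and spin configurations -/

/-- Vertices of the hypercubic lattice `ℤ^d`. -/
abbrev Site (d : ℕ) : Type := Fin d → ℤ

/-- Nearest-neighbor graph on `ℤ^d`: `x ~ y` iff `∑ |x i - y i| = 1`
(for integer vectors this is the same as Euclidean distance one). -/
def lattice (d : ℕ) : SimpleGraph (Site d) where
  Adj x y := ∑ i, |x i - y i| = 1
  symm := ⟨fun x y h => by simpa only [abs_sub_comm] using h⟩
  loopless := ⟨fun x h => by simp at h⟩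

/-- The neighbors of `x` are exactly the vertices `x ± e_i`. -/
theorem lattice_adj_iff {d : ℕ} (x y : Site d) :
    (lattice d).Adj x y ↔ ∃ i, y = x + Pi.single i 1 ∨ y = x - Pi.single i 1 := by
  change ∑ i, |x i - y i| = 1 ↔ _
  constructor
  · intro h
    have hne : ∃ i, x i - y i ≠ 0 := by
      by_contra! hc
      simp [hc] at h
    obtain ⟨i, hi⟩ := hne
    have h1 : 1 ≤ |x i - y i| := Int.one_le_abs hi
    rw [← Finset.add_sum_erase _ _ (Finset.mem_univ i)] at h
    have h0 : 0 ≤ ∑ j ∈ Finset.univ.erase i, |x j - y j| :=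
      Finset.sum_nonneg fun _ _ => abs_nonneg _
    have hz : ∑ j ∈ Finset.univ.erase i, |x j - y j| = 0 := by omega
    have hz' := (Finset.sum_eq_zero_iff_of_nonneg fun _ _ => abs_nonneg _).1 hz
    have hj : ∀ j, j ≠ i → x j = y j := fun j hji => by
      have := hz' j (by simp [hji])
      rw [abs_eq_zero] at this
      omega
    have hi1 : |x i - y i| = 1 := by omega
    refine ⟨i, ?_⟩
    rcases abs_eq (by norm_num : (0:ℤ) ≤ 1) |>.1 hi1 with h2 | h2
    · right
      funext j
      by_cases hji : j = i
      · subst hji; simp; omega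
      · simp [hji, hj j hji]
    · left
      funext j
      by_cases hji : j = i
      · subst hji; simp; omega
      · simp [hji, hj j hji]
  · rintro ⟨i, rfl | rfl⟩
    · rw [Finset.sum_eq_single i]
      · simp
      · intro j _ hj; simp [hj]
      · simp
    · rw [Finset.sum_eq_single i]
      · simp
      · intro j _ hj; simp [hj]
      · simp

/-- Spin configurations; `ℤˣ = {1, -1}`. -/
abbrev Config (d : ℕ) : Type := Site d → ℤˣ

/-- The sum of the `2 d` spins at the nearest neighbors `x ± e_i` of `x`. -/
def neighborSum {d : ℕ} (s : Config d) (x : Site d) : ℤ :=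
  ∑ i : Fin d, ((s (x + Pi.single i 1) : ℤ) + (s (x - Pi.single i 1) : ℤ))

/-- The new spin at `x` when its clock rings: the value of the strict majority of the neighbors,
and in case of a tie the value given by the coin (heads, i.e. `true`, gives `+1`). -/
def updatedSpin {d : ℕ} (s : Config d) (x : Site d) (coin : Bool) : ℤˣ :=
  if 0 < neighborSum s x then 1
  else if neighborSum s x < 0 then -1
  else if coin then 1 else -1

/-! ### The random environment and the randomness of the dynamics -/

/-- The three types of vertices. -/
inductive VertexType : Type
  | frozenPlus
  | frozenMinus
  | unfrozen

instance : MeasurableSpace VertexType := ⊤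

/-- The spin at time zero of a vertex of the given type: a frozen vertex carries its frozen value,
an unfrozen vertex the prescribed value. -/
def VertexType.spin : VertexType → ℤˣ → ℤˣ
  | .frozenPlus, _ => 1
  | .frozenMinus, _ => -1
  | .unfrozen, s => s

/-- Environments: an assignment of types to the vertices. -/
abbrev Environment (d : ℕ) : Type := Site d → VertexType

/-- Waiting times between consecutive clock rings, for every vertex: entry `0` is the waiting time
from time zero to the first ring (numbered `0`), entry `k + 1` the one from ring `k`
to ring `k + 1`. -/
abbrev Clocks (d : ℕ) : Type := Site d → ℕ → ℝ

/-- A tie-breaking coin for every vertex and every ring of its clock. -/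
abbrev Coins (d : ℕ) : Type := Site d → ℕ → Bool

/-- A realization of the environment, of the clocks and of the coins. -/
abbrev Sample (d : ℕ) : Type := Environment d × (Clocks d × Coins d)

/-- The time of ring number `k = 0, 1, 2, …` of the clock at `x`. -/
def ringTime {d : ℕ} (τ : Clocks d) (x : Site d) (k : ℕ) : ℝ :=
  ∑ i ∈ Finset.range (k + 1), τ x i

/-- The law of the type of one vertex. -/
noncomputable def vertexLaw (ρp ρm : ℝ) : Measure VertexType :=
  ENNReal.ofReal ρp • Measure.dirac .frozenPlus
    + ENNReal.ofReal ρm • Measure.dirac .frozenMinus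
    + ENNReal.ofReal (1 - (ρp + ρm)) • Measure.dirac .unfrozen

/-- The law of the environment: the types are i.i.d. -/
noncomputable def environmentLaw (d : ℕ) (ρp ρm : ℝ) : Measure (Environment d) :=
  Measure.infinitePi fun _ : Site d => vertexLaw ρp ρm

/-- The law of the clocks: independent rate 1 Poisson processes, i.e. i.i.d. exponential waiting
times of rate 1. -/
noncomputable def clockLaw (d : ℕ) : Measure (Clocks d) :=
  Measure.infinitePi fun _ : Site d => Measure.infinitePi fun _ : ℕ => expMeasure 1

/-- The law of the coins: i.i.d. fair coins. -/
noncomputable def coinLaw (d : ℕ) : Measure (Coins d) :=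
  Measure.infinitePi fun _ : Site d =>
    Measure.infinitePi fun _ : ℕ => (PMF.uniformOfFintype Bool).toMeasure

/-- The overall probability measure: environment, clocks and coins are independent. -/
noncomputable def law (d : ℕ) (ρp ρm : ℝ) : Measure (Sample d) :=
  (environmentLaw d ρp ρm).prod ((clockLaw d).prod (coinLaw d))

theorem isProbabilityMeasure_vertexLaw {ρp ρm : ℝ} (hp : 0 ≤ ρp) (hm : 0 ≤ ρm)
    (h : ρp + ρm ≤ 1) : IsProbabilityMeasure (vertexLaw ρp ρm) := by
  constructor
  simp only [vertexLaw, Measure.coe_add, Measure.coe_smul, Pi.add_apply, Pi.smul_apply,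
    measure_univ, smul_eq_mul, mul_one]
  rw [← ENNReal.ofReal_add hp hm, ← ENNReal.ofReal_add (by linarith) (by linarith)]
  simp

/-- For admissible densities the overall measure is indeed a probability measure. -/
theorem isProbabilityMeasure_law (d : ℕ) {ρp ρm : ℝ} (hp : 0 ≤ ρp) (hm : 0 ≤ ρm)
    (h : ρp + ρm ≤ 1) : IsProbabilityMeasure (law d ρp ρm) := by
  have := isProbabilityMeasure_vertexLaw hp hm h
  have : IsProbabilityMeasure (expMeasure 1) := isProbabilityMeasure_expMeasure one_pos
  unfold law environmentLaw clockLaw coinLaw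
  infer_instance

/-! ### The dynamics -/

/-- `σ` (with `σ t x` the spin at `x` at time `t`) is a trajectory of the dynamics with frozen
vertices, driven by the sample `ω` and started from `s₀`:
* at time zero the unfrozen vertices carry the values of `s₀`, the frozen ones their frozen values;
* frozen vertices never flip;
* spins do not change while the clock of their vertex does not ring;
* when the clock of an unfrozen vertex rings, its spin takes the updated value, computed
  from the configuration just before the ring. -/
structure IsTrajectory {d : ℕ} (ω : Sample d) (s₀ : Config d) (σ : ℝ≥0 → Config d) : Prop where
  init : ∀ x, σ 0 x = (ω.1 x).spin (s₀ x)
  frozen : ∀ x, ω.1 x ≠ .unfrozen → ∀ t, σ t x = σ 0 x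
  const : ∀ x (s t : ℝ≥0), s ≤ t →
    (∀ k, ¬ ((s : ℝ) < ringTime ω.2.1 x k ∧ ringTime ω.2.1 x k ≤ t)) → σ t x = σ s x
  update : ∀ x, ω.1 x = .unfrozen → ∀ (k : ℕ) (t : ℝ≥0), (t : ℝ) = ringTime ω.2.1 x k →
    ∀ᶠ s in 𝓝[<] t, σ t x = updatedSpin (σ s) x (ω.2.2 x k)

/-- The number of rings at `x` strictly before time `t`. -/
noncomputable def ringsBefore {d : ℕ} (τ : Clocks d) (x : Site d) (t : ℝ) : ℕ := sInf {k | t ≤ ringTime τ x k}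

/-- The number of rings at `x` up to and including time `t`. -/
noncomputable def ringsUpTo {d : ℕ} (τ : Clocks d) (x : Site d) (t : ℝ) : ℕ := sInf {k | t < ringTime τ x k}

open Classical in
/-- Trajectories exist, from every initial configuration, for every sample whose waiting times are
positive and whose clocks ring finitely often in bounded time. -/
theorem exists_isTrajectory {d : ℕ} (ω : Sample d) (hpos : ∀ x k, 0 < ω.2.1 x k)
    (htop : ∀ x, Tendsto (ringTime ω.2.1 x) atTop atTop) (s₀ : Config d) :
    ∃ σ, IsTrajectory ω s₀ σ := by
  obtain ⟨η, τ, c⟩ := ω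
  simp only at hpos htop
  have hmono : ∀ x, StrictMono (ringTime τ x) := fun x => strictMono_nat_of_lt_succ fun k => by
    simp only [ringTime]
    rw [Finset.sum_range_succ _ (k + 1)]
    linarith [hpos x (k + 1)]
  have hneLt : ∀ x t, {k | t ≤ ringTime τ x k}.Nonempty := fun x t =>
    ((htop x).eventually (eventually_ge_atTop t)).exists
  have hneLe : ∀ x t, {k | t < ringTime τ x k}.Nonempty := fun x t =>
    ((htop x).eventually (eventually_gt_atTop t)).exists
  have hLt : ∀ x t k, k < ringsBefore τ x t ↔ ringTime τ x k < t := by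
    intro x t k
    constructor
    · intro h; by_contra! hc
      exact absurd (Nat.sInf_le (s := {k | t ≤ ringTime τ x k}) hc)
        (by unfold ringsBefore at h; omega)
    · intro h; by_contra! hc
      have := Nat.sInf_mem (hneLt x t)
      have h2 := (hmono x).monotone hc
      exact absurd (lt_of_lt_of_le h this) (not_lt.2 h2)
  have hLe : ∀ x t k, k < ringsUpTo τ x t ↔ ringTime τ x k ≤ t := by
    intro x t k
    constructor
    · intro h; by_contra! hc
      exact absurd (Nat.sInf_le (s := {k | t < ringTime τ x k}) hc)
        (by unfold ringsUpTo at h; omega)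
    · intro h; by_contra! hc
      have := Nat.sInf_mem (hneLe x t)
      have h2 := (hmono x).monotone hc
      exact absurd (lt_of_le_of_lt h this) (not_lt.2 h2)
  let L : (Site d → ℕ → ℤˣ) → ℝ → Config d := fun a t y => a y (ringsBefore τ y t)
  let Eq : Site d × ℕ → Set (Site d → ℕ → ℤˣ) := fun e =>
    {a | a e.1 0 = (η e.1).spin (s₀ e.1) ∧ a e.1 (e.2 + 1) =
      if η e.1 = .unfrozen then updatedSpin (L a (ringTime τ e.1 e.2)) e.1 (c e.1 e.2)
      else a e.1 e.2}
  have hfin : ∀ n : ℕ, ∀ E : Finset (Site d × ℕ), E.card = n →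
      ∃ a : Site d → ℕ → ℤˣ, (∀ x, a x 0 = (η x).spin (s₀ x)) ∧ ∀ e ∈ E, a ∈ Eq e := by
    intro n
    induction n with
    | zero =>
      intro E hE
      rw [Finset.card_eq_zero] at hE
      subst hE
      exact ⟨fun x _ => (η x).spin (s₀ x), fun _ => rfl, by simp⟩
    | succ n ih =>
      intro E hE
      have hne : E.Nonempty := by rw [← Finset.card_pos]; omega
      obtain ⟨e, heE, hmax⟩ := E.exists_max_image (fun e => ringTime τ e.1 e.2) hne
      obtain ⟨a, ha0, ha⟩ := ih (E.erase e) (by rw [Finset.card_erase_of_mem heE]; omega)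
      obtain ⟨x, k⟩ := e
      let v : ℤˣ := if η x = .unfrozen then updatedSpin (L a (ringTime τ x k)) x (c x k)
        else a x k
      let b : Site d → ℕ → ℤˣ := fun y j => if y = x ∧ j = k + 1 then v else a y j
      have hb0 : ∀ y, b y 0 = (η y).spin (s₀ y) := fun y => by simp [b, ha0]
      have hLb : ∀ e ∈ E, L b (ringTime τ e.1 e.2) = L a (ringTime τ e.1 e.2) := by
        intro e he
        funext y
        simp only [L, b]
        rw [if_neg]
        rintro ⟨rfl, h⟩
        have := (hLt y (ringTime τ e.1 e.2) k).1 (by omega)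
        exact absurd (hmax e he) (not_le.2 this)
      refine ⟨b, hb0, fun e he => ⟨hb0 _, ?_⟩⟩
      have hbk : b e.1 e.2 = a e.1 e.2 := by
        simp only [b]
        rw [if_neg]
        rintro ⟨h1, h2⟩
        have := hmax e he
        simp only [h1, h2] at this
        exact absurd this (not_le.2 (hmono x (Nat.lt_succ_self k)))
      rw [hLb e he, hbk]
      by_cases hex : e = (x, k)
      · subst hex; simp [b, v]
      · have hbk1 : b e.1 (e.2 + 1) = a e.1 (e.2 + 1) := by
          simp only [b]
          rw [if_neg]
          rintro ⟨h1, h2⟩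
          exact hex (Prod.ext h1 (by simpa using h2))
        rw [hbk1]
        exact (ha e (Finset.mem_erase.2 ⟨hex, he⟩)).2
  have hcont : ∀ e : Site d × ℕ, IsClosed (Eq e) := by
    intro e
    have hev : ∀ (y : Site d) (j : ℕ), Continuous fun a : Site d → ℕ → ℤˣ => a y j := by
      intro y j; fun_prop
    have hns : Continuous fun a : Site d → ℕ → ℤˣ =>
        neighborSum (L a (ringTime τ e.1 e.2)) e.1 := by
      unfold neighborSum
      refine continuous_finsetSum _ fun i _ => ?_
      exact ((continuous_of_discreteTopology (f := fun u : ℤˣ => (u : ℤ))).comp (hev _ _)).add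
        ((continuous_of_discreteTopology (f := fun u : ℤˣ => (u : ℤ))).comp (hev _ _))
    refine (isClosed_eq (hev _ _) continuous_const).inter (isClosed_eq (hev _ _) ?_)
    split_ifs
    · exact (continuous_of_discreteTopology (f := fun z : ℤ => (if 0 < z then (1 : ℤˣ)
        else if z < 0 then -1 else if c e.1 e.2 then 1 else -1))).comp hns
    · exact hev _ _
  obtain ⟨a, ha⟩ : (⋂ e, Eq e).Nonempty := by
    refine CompactSpace.iInter_nonempty hcont fun E => ?_
    obtain ⟨a, -, ha⟩ := hfin _ E rfl
    exact ⟨a, by simpa using ha⟩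
  rw [Set.mem_iInter] at ha
  have hstep : ∀ x k, ringsUpTo τ x (ringTime τ x k) = k + 1 := fun x k => by
    have h1 : ∀ j, j < ringsUpTo τ x (ringTime τ x k) ↔ j ≤ k := fun j => by
      rw [hLe, (hmono x).le_iff_le]
    have := h1 k; have := h1 (k + 1); omega
  refine ⟨fun t x => a x (ringsUpTo τ x t), ?_, ?_, ?_, ?_⟩
  · intro x
    have : ringsUpTo τ x ((0 : ℝ≥0) : ℝ) = 0 := by
      have h := hLe x 0 0
      have : 0 < ringTime τ x 0 := by simp [ringTime, hpos]
      simp only [NNReal.coe_zero]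
      by_contra hc
      linarith [h.1 (by omega)]
    simp only [this]
    exact (ha (x, 0)).1
  · intro x hx t
    have : ∀ k, a x k = a x 0 := fun k => by
      induction k with
      | zero => rfl
      | succ k ih => rw [(ha (x, k)).2]; simp only; rw [if_neg hx, ih]
    simp only [this]
  · intro x s t hst h
    have : ringsUpTo τ x t = ringsUpTo τ x s := by
      have h1 : ∀ j, j < ringsUpTo τ x t ↔ j < ringsUpTo τ x s := fun j => by
        rw [hLe, hLe]
        constructor
        · intro hj; by_contra! hc; exact h j ⟨hc, hj⟩
        · intro hj; exact hj.trans (by exact_mod_cast hst)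
      have := h1 (ringsUpTo τ x t); have := h1 (ringsUpTo τ x s); omega
    simp only [this]
  · intro x hx k t ht
    simp only at hx ht ⊢
    have hev : ∀ y, ∀ᶠ s : ℝ≥0 in 𝓝[<] t, ringsUpTo τ y s = ringsBefore τ y t := by
      intro y
      have : ∀ᶠ s : ℝ≥0 in 𝓝[<] t, ∀ j ∈ Finset.range (ringsBefore τ y t), ringTime τ y j ≤ s := by
        rw [Filter.eventually_all_finset]
        intro j hj
        have hj := (hLt y t j).1 (by simpa using hj)
        have : ∀ᶠ s : ℝ≥0 in 𝓝 t, ringTime τ y j < s :=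
          (NNReal.continuous_coe.tendsto t).eventually (eventually_gt_nhds hj)
        exact (this.filter_mono nhdsWithin_le_nhds).mono fun s hs => hs.le
      filter_upwards [this, self_mem_nhdsWithin] with s hs hst
      have hst : (s : ℝ) < t := by exact_mod_cast hst
      have h1 : ∀ j, j < ringsUpTo τ y s ↔ j < ringsBefore τ y t := fun j => by
        constructor
        · intro hj; rw [hLt]; exact ((hLe _ _ _).1 hj).trans_lt hst
        · intro hj; rw [hLe]; exact hs j (by simpa using hj)
      have := h1 (ringsUpTo τ y s); have := h1 (ringsBefore τ y t); omega
    have hall : ∀ᶠ s : ℝ≥0 in 𝓝[<] t, ∀ i : Fin d,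
        ringsUpTo τ (x + Pi.single i 1) s = ringsBefore τ (x + Pi.single i 1) t ∧
        ringsUpTo τ (x - Pi.single i 1) s = ringsBefore τ (x - Pi.single i 1) t := by
      rw [Filter.eventually_all]
      exact fun i => (hev _).and (hev _)
    filter_upwards [hall] with s hs
    have hE := (ha (x, k)).2
    simp only at hE
    rw [if_pos hx] at hE
    rw [ht, hstep, hE, ← ht]
    simp only [updatedSpin, neighborSum, L]
    simp only [hs]

/-- `x` is (eventually) fixed with spin `-1`. -/
def IsFixedMinus {d : ℕ} (σ : ℝ≥0 → Config d) (x : Site d) : Prop :=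
  ∃ T : ℝ≥0, ∀ t, T ≤ t → σ t x = -1

/-- `x` is a flipper: its spin changes forever. -/
def IsFlipper {d : ℕ} (σ : ℝ≥0 → Config d) (x : Site d) : Prop :=
  ∀ T : ℝ≥0, ∃ s t : ℝ≥0, T ≤ s ∧ s ≤ t ∧ σ t x ≠ σ s x

/-- The set of all (eventually) fixed `-1` vertices and flippers. -/
def minusOrFlipper {d : ℕ} (σ : ℝ≥0 → Config d) : Set (Site d) :=
  {x | IsFixedMinus σ x ∨ IsFlipper σ x}

/-- A set of vertices percolates if its induced nearest-neighbor subgraph has an infinite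
connected component. -/
def Percolates {d : ℕ} (C : Set (Site d)) : Prop :=
  ∃ c : ((lattice d).induce C).ConnectedComponent, c.supp.Infinite

end FrozenMajority

open FrozenMajority

/-! Call a cube good if its corners are frozen plus, it contains no frozen minus, and its frozen
plus vertices span it under bootstrap percolation with threshold `d`. In a good cube all spins are
eventually plus, whatever the initial configuration. A vertex that is not a corner has more than `d`
of its `2d` neighbors in the cube, so a cube that is entirely plus stays so
(`IsTrajectory.stays_plus`). It does become entirely plus: a ring showing heads turns a vertex with
at least `d` plus neighbors plus, so the finitely many bootstrap rounds are carried out in a time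
window in which all clocks of the cube ring often enough and all coins show heads. Almost surely
such a window exists for every finite set and every number of rounds (`ae_exists_headsWindow`). This
event does not involve the initial configuration, hence the simultaneity.

It remains to see that vertices without a good cube around them do not percolate. By induction on
the number of directions, the probability that a cube is not spanned decays faster than any power of
its side (`rapidDecay`): a vertex next to a filled cube has one occupied neighbor for free, so the
next layer needs only a spanning event in one dimension less and with threshold one less. Among many
concentric cubes, one has frozen plus corners with high probability. So a block of large side `n`
has a spanned cube with plus corners around it with probability near one. As this depends on `ρp`
only, `n` is fixed first, and then `ρm` is taken so small that a frozen minus nearby is unlikely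
too. Bad blocks are rare and of finite range, and counting self-avoiding paths of blocks
(`ae_forall_exists_no_bad_path`) excludes infinite components. -/

namespace FrozenMajority

/-! ### Events depending on finitely many coordinates -/

section LocalEvents

variable {ι α κ : Type*}

/-- Membership in `E` depends only on the coordinates in `S`. -/
def LocalOn (S : Finset ι) (E : Set (ι → α)) : Prop :=
  ∀ η η' : ι → α, (∀ x ∈ S, η x = η' x) → η ∈ E → η' ∈ E

theorem LocalOn.mono {S T : Finset ι} {E : Set (ι → α)} (h : LocalOn S E) (hST : S ⊆ T) :
    LocalOn T E := fun η η' hη => h η η' fun x hx => hη x (hST hx)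

theorem LocalOn.compl {S : Finset ι} {E : Set (ι → α)} (h : LocalOn S E) : LocalOn S Eᶜ :=
  fun η η' hη hE hE' => hE (h η' η (fun x hx => (hη x hx).symm) hE')

theorem LocalOn.iInter {S : Finset ι} {β : Sort*} {E : β → Set (ι → α)}
    (h : ∀ b, LocalOn S (E b)) : LocalOn S (⋂ b, E b) := fun η η' hη hE => by
  simp only [Set.mem_iInter] at hE ⊢
  exact fun b => h b η η' hη (hE b)

theorem LocalOn.union {S : Finset ι} {E F : Set (ι → α)} (hE : LocalOn S E) (hF : LocalOn S F) :
    LocalOn S (E ∪ F) := fun η η' hη h => h.imp (hE η η' hη) (hF η η' hη)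

/-- For finite `α` the set of patterns on `S` is a subset of a finite type. This form therefore
makes locality alone yield measurability and independence. -/
theorem LocalOn.eq_preimage [Inhabited α] {S : Finset ι} {E : Set (ι → α)} (h : LocalOn S E) :
    E = S.restrict ⁻¹' (S.restrict '' E) := by
  refine (Set.subset_preimage_image _ _).antisymm ?_
  rintro η ⟨η', hη', he⟩
  exact h η' η (fun x hx => congrFun he ⟨x, hx⟩) hη'

theorem localOn_forall_mem_eq (S : Finset ι) (b : α) :
    LocalOn S {η : ι → α | ∀ x ∈ S, η x = b} := fun _ _ h hE x hx => (h x hx).symm.trans (hE x hx)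

variable [MeasurableSpace α] [MeasurableSingletonClass α]

theorem measureReal_forall_mem_eq (ν : Measure α) [IsProbabilityMeasure ν]
    (S : Finset ι) (b : α) :
    (Measure.infinitePi fun _ : ι => ν).real {η | ∀ x ∈ S, η x = b} = ν.real {b} ^ S.card := by
  have : {η : ι → α | ∀ x ∈ S, η x = b} = (S : Set ι).pi fun _ => {b} := by
    ext; simp [Set.mem_pi]
  rw [this, measureReal_def, Measure.infinitePi_pi _ fun _ _ => measurableSet_singleton b]
  simp [measureReal_def]

variable [Finite α] [Inhabited α]

theorem LocalOn.measurableSet {S : Finset ι} {E : Set (ι → α)} (h : LocalOn S E) :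
    MeasurableSet E := by
  rw [h.eq_preimage]
  exact S.measurable_restrict (MeasurableSet.of_discrete)

variable (ν : Measure α) [IsProbabilityMeasure ν]

theorem LocalOn.measureReal_inter {S T : Finset ι} {E F : Set (ι → α)} (hE : LocalOn S E)
    (hF : LocalOn T F) (hST : Disjoint S T) :
    (Measure.infinitePi fun _ : ι => ν).real (E ∩ F)
      = (Measure.infinitePi fun _ : ι => ν).real E * (Measure.infinitePi fun _ : ι => ν).real F := by
  have hi : iIndepFun (fun (i : ι) (η : ι → α) => η i) (Measure.infinitePi fun _ : ι => ν) :=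
    iIndepFun_infinitePi (X := fun _ a => a) fun _ => measurable_id
  have h := hi.indepFun_finset S T hST fun i => measurable_pi_apply i
  have := h.measure_inter_preimage_eq_mul (S.restrict '' E) (T.restrict '' F)
    MeasurableSet.of_discrete MeasurableSet.of_discrete
  have h1 : (fun (η : ι → α) (i : S) => η i) ⁻¹' (S.restrict '' E) = E := hE.eq_preimage.symm
  have h2 : (fun (η : ι → α) (i : T) => η i) ⁻¹' (T.restrict '' F) = F := hF.eq_preimage.symm
  rw [h1, h2] at this
  simp only [measureReal_def, this, ENNReal.toReal_mul]

theorem LocalOn.measureReal_biInter [DecidableEq ι] {S : κ → Finset ι} {E : κ → Set (ι → α)}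
    (J : Finset κ)
    (hE : ∀ k ∈ J, LocalOn (S k) (E k)) (hS : ∀ k ∈ J, ∀ l ∈ J, k ≠ l → Disjoint (S k) (S l)) :
    (Measure.infinitePi fun _ : ι => ν).real (⋂ k ∈ J, E k)
      = ∏ k ∈ J, (Measure.infinitePi fun _ : ι => ν).real (E k) := by
  classical
  induction J using Finset.induction_on with
  | empty => simp
  | insert k J hk ih =>
    rw [Finset.prod_insert hk, ← ih (fun l hl => hE l (Finset.mem_insert_of_mem hl))
      (fun l hl m hm => hS l (Finset.mem_insert_of_mem hl) m (Finset.mem_insert_of_mem hm)),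
      Finset.set_biInter_insert]
    refine LocalOn.measureReal_inter (S := S k) (T := J.biUnion S) ν
      (hE k (Finset.mem_insert_self _ _)) ?_ ?_
    · refine LocalOn.iInter fun l => LocalOn.iInter fun hl => ?_
      exact (hE l (Finset.mem_insert_of_mem hl)).mono (Finset.subset_biUnion_of_mem S hl)
    · rw [Finset.disjoint_biUnion_right]
      intro l hl
      exact hS k (Finset.mem_insert_self _ _) l (Finset.mem_insert_of_mem hl)
        (by rintro rfl; exact hk hl)

end LocalEvents

/-! ### Bootstrap percolation in cubes -/

section Bootstrap

variable {d : ℕ}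

/-- Side lengths of the cube of side `l` spanned by the directions in `I`. -/
def side (I : Finset (Fin d)) (l : ℕ) (j : Fin d) : ℤ := if j ∈ I then (l : ℤ) else 1

/-- The cube of side `l`, with lowest corner `a`, spanned by the directions in `I`. -/
noncomputable def cube (I : Finset (Fin d)) (l : ℕ) (a : Site d) : Finset (Site d) :=
  Fintype.piFinset fun j => Finset.Ico (a j) (a j + side I l j)

theorem mem_cube {I : Finset (Fin d)} {l : ℕ} {a x : Site d} :
    x ∈ cube I l a ↔ ∀ j, a j ≤ x j ∧ x j < a j + side I l j := by
  simp [cube]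

open Classical in
/-- The number of neighbors of `x` in `D`, counting only the directions in `I`. -/
noncomputable def nbrsIn (I : Finset (Fin d)) (D : Set (Site d)) (x : Site d) : ℕ :=
  ∑ i ∈ I, ((if x + Pi.single i 1 ∈ D then 1 else 0) + (if x - Pi.single i 1 ∈ D then 1 else 0))

theorem nbrsIn_mono (I : Finset (Fin d)) {D D' : Set (Site d)} (h : D ⊆ D') (x : Site d) :
    nbrsIn I D x ≤ nbrsIn I D' x := by
  classical
  refine Finset.sum_le_sum fun i _ => add_le_add ?_ ?_
  · split_ifs with h1 h2 <;> first | exact le_rfl | exact absurd (h h1) h2 | exact Nat.zero_le _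
  · split_ifs with h1 h2 <;> first | exact le_rfl | exact absurd (h h1) h2 | exact Nat.zero_le _

/-- A neighbor in direction `i` that is already occupied pays for the difference between the
thresholds `#I` and `#I - 1`. This drives the induction on the dimension. -/
theorem nbrsIn_erase_add_one_le {I : Finset (Fin d)} {i : Fin d} (hi : i ∈ I) {D : Set (Site d)}
    {x : Site d} (h : x + Pi.single i 1 ∈ D ∨ x - Pi.single i 1 ∈ D) :
    nbrsIn (I.erase i) D x + 1 ≤ nbrsIn I D x := by
  classical
  unfold nbrsIn
  rw [← Finset.sum_erase_add _ _ hi]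
  gcongr
  rcases h with h | h <;> simp [h]

/-- `C` is spanned by `A`: every set which contains `A ∩ C` and every vertex of `C` with at least
`#I` neighbors (in the directions of `I`) in it contains `C`. -/
def Spanned (A : Set (Site d)) (I : Finset (Fin d)) (C : Finset (Site d)) : Prop :=
  ∀ D : Set (Site d), (∀ x ∈ C, x ∈ A → x ∈ D) → (∀ x ∈ C, I.card ≤ nbrsIn I D x → x ∈ D) →
    ∀ x ∈ C, x ∈ D

theorem spanned_of_subset {A : Set (Site d)} {I : Finset (Fin d)} {C : Finset (Site d)}
    (h : ∀ x ∈ C, x ∈ A) : Spanned A I C := fun _ hD _ x hx => hD x hx (h x hx)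

/-- With threshold zero every vertex is forced; this is the base of the induction on directions. -/
theorem spanned_empty (A : Set (Site d)) (C : Finset (Site d)) : Spanned A ∅ C :=
  fun _ _ h x hx => h x hx (by simp)

/-- The possible lowest corners of the faces of side `l`, orthogonal to `i`, in the cube
of side `n` at `a`. -/
noncomputable def faceCorners (I : Finset (Fin d)) (n l : ℕ) (a : Site d) (i : Fin d) : Finset (Site d) :=
  Fintype.piFinset fun j => if j = i then Finset.Ico (a j) (a j + n) else
    if j ∈ I then Finset.Icc (a j) (a j + n - l) else {a j}

theorem mem_faceCorners {I : Finset (Fin d)} {n l : ℕ} {a b : Site d} {i : Fin d} :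
    b ∈ faceCorners I n l a i ↔ ∀ j, if j = i then a j ≤ b j ∧ b j < a j + n else
      if j ∈ I then a j ≤ b j ∧ b j + l ≤ a j + n else b j = a j := by
  simp only [faceCorners, Fintype.mem_piFinset]
  refine forall_congr' fun j => ?_
  split_ifs <;> (simp; try omega)

theorem card_faceCorners_le (I : Finset (Fin d)) {n l : ℕ} (a : Site d) (i : Fin d) (hln : l ≤ n) :
    (faceCorners I n l a i).card ≤ n * (n - l + 1) ^ d := by
  rw [faceCorners, Fintype.card_piFinset, ← Finset.mul_prod_erase _ _ (Finset.mem_univ i)]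
  refine Nat.mul_le_mul (by simp) ?_
  calc _ ≤ ∏ _j ∈ Finset.univ.erase i, (n - l + 1) := by
        refine Finset.prod_le_prod' fun j hj => ?_
        rw [if_neg (Finset.ne_of_mem_erase hj)]
        split_ifs
        · simp only [Int.card_Icc]; omega
        · simp
    _ ≤ _ := by
        rw [Finset.prod_const]
        refine Nat.pow_le_pow_right (by omega) ?_
        exact (Finset.card_le_univ _).trans (by simp)

theorem face_subset {I : Finset (Fin d)} {n l : ℕ} {a b : Site d} {i : Fin d} (hi : i ∈ I)
    (hb : b ∈ faceCorners I n l a i) : cube (I.erase i) l b ⊆ cube I n a := by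
  intro x hx
  rw [mem_cube] at hx ⊢
  rw [mem_faceCorners] at hb
  intro j
  have h1 := hx j
  have h2 := hb j
  simp only [side, Finset.mem_erase] at h1 ⊢
  by_cases hji : j = i
  · subst hji; simp [hi] at h1 h2 ⊢; omega
  · by_cases hjI : j ∈ I
    · simp [hji, hjI] at h1 h2 ⊢; omega
    · simp [hji, hjI] at h1 h2 ⊢; omega

theorem face_disjoint {I : Finset (Fin d)} {l : ℕ} {b s : Site d} {i : Fin d} (hi : i ∈ I)
    (hb : b i < s i ∨ s i + l ≤ b i) : Disjoint (cube I l s) (cube (I.erase i) l b) := by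
  rw [Finset.disjoint_left]
  intro x hx hx'
  rw [mem_cube] at hx hx'
  have h1 := hx i
  have h2 := hx' i
  simp [side, hi] at h1 h2
  omega

/-- A spanned seed grows to the whole cube if all faces of its size off the seed are spanned. -/
theorem spanned_of_seed {A : Set (Site d)} {I : Finset (Fin d)} {n l : ℕ} {a s : Site d}
    (hl : 1 ≤ l) (hln : l ≤ n)
    (hs : ∀ j, if j ∈ I then a j ≤ s j ∧ s j + l ≤ a j + n else s j = a j)
    (hseed : Spanned A I (cube I l s))
    (hface : ∀ i ∈ I, ∀ b ∈ faceCorners I n l a i, (b i < s i ∨ s i + l ≤ b i) →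
      Spanned A (I.erase i) (cube (I.erase i) l b)) :
    Spanned A I (cube I n a) := by
  intro D hA hD
  have hsub : ∀ y : Site d, (∀ j, if j ∈ I then a j ≤ y j ∧ y j + l ≤ a j + n else y j = a j) →
      cube I l y ⊆ cube I n a := by
    intro y hy x hx
    rw [mem_cube] at hx ⊢
    intro j
    have h1 := hx j
    have h2 := hy j
    by_cases hj : j ∈ I
    · simp [side, hj] at h1 h2 ⊢; omega
    · simp [side, hj] at h1 h2 ⊢; omega
  -- A face lying against occupied vertices has one neighbor for free at each of its vertices, so
  -- being spanned in the remaining directions with the lower threshold fills it.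
  have hstep : ∀ i ∈ I, ∀ b ∈ faceCorners I n l a i, (b i < s i ∨ s i + l ≤ b i) →
      (∀ x ∈ cube (I.erase i) l b, x + Pi.single i 1 ∈ D ∨ x - Pi.single i 1 ∈ D) →
      ∀ x ∈ cube (I.erase i) l b, x ∈ D := by
    intro i hi b hb hbs hx
    refine hface i hi b hb hbs D (fun x hx => hA x (face_subset hi hb hx)) fun x hxF hc => ?_
    refine hD x (face_subset hi hb hxF) ?_
    have := nbrsIn_erase_add_one_le hi (hx x hxF)
    rw [Finset.card_erase_of_mem hi] at hc
    omega
  -- The filled cube of side `l` is moved from `s` to `y` by unit steps, by induction on their ℓ¹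
  -- distance. Each new position differs from one nearer to the seed by a single face.
  have key : ∀ (m : ℕ) (y : Site d), (∑ j, (y j - s j).natAbs) = m →
      (∀ j, if j ∈ I then a j ≤ y j ∧ y j + l ≤ a j + n else y j = a j) →
      ∀ x ∈ cube I l y, x ∈ D := by
    intro m
    induction m with
    | zero =>
      intro y hm hy
      have : y = s := by
        funext j
        have := (Finset.sum_eq_zero_iff.1 hm) j (Finset.mem_univ j)
        omega
      rw [this] at hy ⊢
      exact hseed D (fun x hx => hA x (hsub s hs hx)) fun x hx => hD x (hsub s hs hx)
    | succ m ih =>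
      intro y hm hy
      obtain ⟨i, -, hi⟩ := Finset.exists_ne_zero_of_sum_ne_zero (by omega : (∑ j, (y j - s j).natAbs) ≠ 0)
      have hiI : i ∈ I := by
        by_contra hiI
        have h1 := hs i
        have h2 := hy i
        rw [if_neg hiI] at h1 h2
        omega
      have hsi := hs i
      have hyi := hy i
      rw [if_pos hiI] at hsi hyi
      have hdist : ∀ t : ℤ, (y i + t - s i).natAbs + 1 = (y i - s i).natAbs →
          (∑ j, ((y + Pi.single i t : Site d) j - s j).natAbs) = m := by
        intro t ht
        rw [← Finset.add_sum_erase _ _ (Finset.mem_univ i)] at hm ⊢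
        have : ∑ j ∈ Finset.univ.erase i, ((y + Pi.single i t : Site d) j - s j).natAbs
            = ∑ j ∈ Finset.univ.erase i, (y j - s j).natAbs :=
          Finset.sum_congr rfl fun j hj => by simp [Finset.ne_of_mem_erase hj]
        rw [this]
        simp only [Pi.add_apply, Pi.single_eq_same]
        omega
      have hin : ∀ t : ℤ, (a i ≤ y i + t ∧ y i + t + l ≤ a i + n) →
          ∀ j, if j ∈ I then a j ≤ (y + Pi.single i t : Site d) j ∧ (y + Pi.single i t : Site d) j + l ≤ a j + n
            else (y + Pi.single i t : Site d) j = a j := by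
        intro t ht j
        by_cases hji : j = i
        · subst hji; simpa [hiI] using ht
        · simpa [hji] using hy j
      -- If `y` is below the seed in direction `i`, the missing layer is the lowest face, with
      -- corner `y`. Otherwise it is the top face, at height `y i + l - 1`. Either face avoids the
      -- seed's range in direction `i`, as `hface` demands.
      rcases lt_or_gt_of_ne (show y i ≠ s i by omega) with hlt | hgt
      · have hD' := ih (y + Pi.single i 1) (hdist 1 (by omega)) (hin 1 (by omega))
        have hb : y ∈ faceCorners I n l a i := by
          rw [mem_faceCorners]
          intro j
          by_cases hji : j = i
          · subst hji; simp; omega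
          · simpa [hji] using hy j
        have hmem : ∀ x ∈ cube (I.erase i) l y, x + Pi.single i 1 ∈ cube I l (y + Pi.single i 1) := by
          intro x hx
          rw [mem_cube] at hx ⊢
          intro j
          have h1 := hx j
          by_cases hji : j = i
          · subst hji; simp [side, hiI] at h1 ⊢; omega
          · simpa [side, hji] using h1
        have hF := hstep i hiI y hb (by omega) fun x hx => Or.inl (hD' _ (hmem x hx))
        intro x hx
        rw [mem_cube] at hx
        by_cases hxi : x i = y i
        · refine hF x (mem_cube.2 fun j => ?_)
          have h1 := hx j
          by_cases hji : j = i
          · subst hji; simp [side]; omega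
          · simpa [side, hji] using h1
        · refine hD' x (mem_cube.2 fun j => ?_)
          have h1 := hx j
          by_cases hji : j = i
          · subst hji; simp [side, hiI] at h1 ⊢; omega
          · simpa [side, hji] using h1
      · have hD' := ih (y + Pi.single i (-1)) (hdist (-1) (by omega)) (hin (-1) (by omega))
        have hb : y + Pi.single i ((l : ℤ) - 1) ∈ faceCorners I n l a i := by
          rw [mem_faceCorners]
          intro j
          by_cases hji : j = i
          · subst hji; simp; omega
          · simpa [hji] using hy j
        have hmem : ∀ x ∈ cube (I.erase i) l (y + Pi.single i ((l : ℤ) - 1)),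
            x - Pi.single i 1 ∈ cube I l (y + Pi.single i (-1)) := by
          intro x hx
          rw [mem_cube] at hx ⊢
          intro j
          have h1 := hx j
          by_cases hji : j = i
          · subst hji; simp [side, hiI] at h1 ⊢; omega
          · simpa [side, hji] using h1
        have hF := hstep i hiI _ hb (by simp; omega) fun x hx => Or.inr (hD' _ (hmem x hx))
        intro x hx
        rw [mem_cube] at hx
        by_cases hxi : x i = y i + l - 1
        · refine hF x (mem_cube.2 fun j => ?_)
          have h1 := hx j
          by_cases hji : j = i
          · subst hji; simp [side]; omega
          · simpa [side, hji] using h1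
        · refine hD' x (mem_cube.2 fun j => ?_)
          have h1 := hx j
          by_cases hji : j = i
          · subst hji; simp [side, hiI] at h1 ⊢; omega
          · simpa [side, hji] using h1
  intro x hx
  rw [mem_cube] at hx
  -- The position that starts at `x`, pushed back into the big cube where it would stick out, still
  -- contains `x`.
  refine key _ (fun j => if j ∈ I then min (x j) (a j + n - l) else a j) rfl (fun j => ?_) x
    (mem_cube.2 fun j => ?_)
  · have h1 := hx j
    by_cases hj : j ∈ I
    · simp [side, hj] at h1 ⊢; omega
    · simp [hj]
  · have h1 := hx j
    have h2 := hs j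
    by_cases hj : j ∈ I
    · simp only [side, hj, if_true] at h1 h2 ⊢; omega
    · simpa [side, hj] using h1

end Bootstrap

/-! ### Spanning probabilities -/

section Spanning

variable {d : ℕ}

/-- The event that a cube is spanned by the open vertices. -/
def spannedEvent (I : Finset (Fin d)) (l : ℕ) (a : Site d) : Set (Site d → Bool) :=
  {η | Spanned {x | η x = true} I (cube I l a)}

theorem localOn_spannedEvent (I : Finset (Fin d)) (l : ℕ) (a : Site d) :
    LocalOn (cube I l a) (spannedEvent I l a) := fun _ _ h hE D hA hD =>
  hE D (fun x hx hx' => hA x hx (by simpa [h x hx] using hx')) hD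

/-- All faces of side `l` of the cube of side `n` at `a` are spanned. -/
def facesEvent (I : Finset (Fin d)) (n l : ℕ) (a : Site d) : Set (Site d → Bool) :=
  ⋂ i ∈ I, ⋂ b ∈ faceCorners I n l a i, spannedEvent (I.erase i) l b

variable (ν : Measure Bool) [IsProbabilityMeasure ν]

/-- The law of i.i.d. vertices with marginal law `ν`. -/
noncomputable abbrev siteLaw (d : ℕ) (ν : Measure Bool) [IsProbabilityMeasure ν] :
    Measure (Site d → Bool) := Measure.infinitePi fun _ : Site d => ν

theorem measureReal_compl_facesEvent_le {I : Finset (Fin d)} {n l : ℕ} (hln : l ≤ n) (a : Site d)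
    {q : ℝ} (hq0 : 0 ≤ q)
    (hq : ∀ i ∈ I, ∀ b, (siteLaw d ν).real (spannedEvent (I.erase i) l b)ᶜ ≤ q) :
    (siteLaw d ν).real (facesEvent I n l a)ᶜ ≤ d * (n * (n - l + 1 : ℕ) ^ d) * q := by
  have : (facesEvent I n l a)ᶜ
      = ⋃ i ∈ I, ⋃ b ∈ faceCorners I n l a i, (spannedEvent (I.erase i) l b)ᶜ := by
    simp [facesEvent, Set.compl_iInter]
  rw [this]
  calc _ ≤ ∑ i ∈ I, (siteLaw d ν).real
        (⋃ b ∈ faceCorners I n l a i, (spannedEvent (I.erase i) l b)ᶜ) :=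
        measureReal_biUnion_finset_le _ _
    _ ≤ ∑ i ∈ I, ∑ b ∈ faceCorners I n l a i, (siteLaw d ν).real (spannedEvent (I.erase i) l b)ᶜ :=
        Finset.sum_le_sum fun i _ => measureReal_biUnion_finset_le _ _
    _ ≤ ∑ i ∈ I, ∑ b ∈ faceCorners I n l a i, q :=
        Finset.sum_le_sum fun i hi => Finset.sum_le_sum fun b _ => hq i hi b
    _ ≤ ∑ i ∈ I, (n * (n - l + 1 : ℕ) ^ d) * q := by
        refine Finset.sum_le_sum fun i _ => ?_
        rw [Finset.sum_const, nsmul_eq_mul]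
        gcongr
        exact_mod_cast card_faceCorners_le I a i hln
    _ ≤ _ := by
        have hId : (I.card : ℝ) ≤ d := by exact_mod_cast (Finset.card_le_univ I).trans (by simp)
        rw [Finset.sum_const, nsmul_eq_mul, mul_assoc (d : ℝ)]
        exact mul_le_mul_of_nonneg_right hId (by positivity)

/-- The seed sits at the corner `a`, and only faces disjoint from it are needed for its growth. The
two events depend on disjoint sets of vertices, so their probabilities multiply. -/
theorem measureReal_spannedEvent_mul_le {I : Finset (Fin d)} {n l : ℕ} (hl : 1 ≤ l) (hln : l ≤ n)
    (a : Site d) {q : ℝ} (hq0 : 0 ≤ q)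
    (hq : ∀ i ∈ I, ∀ b, (siteLaw d ν).real (spannedEvent (I.erase i) l b)ᶜ ≤ q) :
    (siteLaw d ν).real (spannedEvent I l a) * (1 - d * (n * (n - l + 1 : ℕ) ^ d) * q)
      ≤ (siteLaw d ν).real (spannedEvent I n a) := by
  classical
  let F : Set (Site d → Bool) := ⋂ i ∈ I, ⋂ b ∈ faceCorners I n l a i,
    ⋂ (_ : b i < a i ∨ a i + l ≤ b i), spannedEvent (I.erase i) l b
  have hFloc : LocalOn (cube I n a \ cube I l a) F := by
    refine LocalOn.iInter fun i => LocalOn.iInter fun hi => LocalOn.iInter fun b =>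
      LocalOn.iInter fun hb => LocalOn.iInter fun hbi => (localOn_spannedEvent _ _ _).mono ?_
    rw [Finset.subset_sdiff]
    exact ⟨face_subset hi hb, (face_disjoint hi hbi).symm⟩
  have hfaces : 1 - d * (n * (n - l + 1 : ℕ) ^ d) * q ≤ (siteLaw d ν).real F := by
    have h1 := measureReal_compl_facesEvent_le ν hln a hq0 hq
    have h2 : (siteLaw d ν).real Fᶜ ≤ (siteLaw d ν).real (facesEvent I n l a)ᶜ := by
      refine measureReal_mono (Set.compl_subset_compl.2 ?_)
      refine Set.iInter₂_mono fun i _ => Set.iInter₂_mono fun b _ => ?_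
      exact Set.subset_iInter fun _ => subset_rfl
    rw [probReal_compl_eq_one_sub hFloc.measurableSet] at h2
    linarith
  calc _ ≤ (siteLaw d ν).real (spannedEvent I l a) * (siteLaw d ν).real F := by gcongr
    _ = (siteLaw d ν).real (spannedEvent I l a ∩ F) :=
        ((localOn_spannedEvent I l a).measureReal_inter ν hFloc Finset.disjoint_sdiff).symm
    _ ≤ _ := by
        refine measureReal_mono ?_
        rintro η ⟨h1, h2⟩
        simp only [F, Set.mem_iInter] at h2
        refine spanned_of_seed hl hln (fun j => ?_) h1 h2
        split_ifs <;> simp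
        exact_mod_cast hln

/-- Since `l * l ≤ n`, there is room for `l` disjoint seeds in a row along one direction, and they
fail independently. If one of them and all the faces are spanned, so is the cube; a union bound
suffices to combine these two requirements. -/
theorem measureReal_compl_spannedEvent_le {I : Finset (Fin d)} (hI : I.Nonempty) {n l : ℕ}
    (hl : 1 ≤ l) (hln : l * l ≤ n) (a : Site d) {p q : ℝ} (hq0 : 0 ≤ q)
    (hp : ∀ b, p ≤ (siteLaw d ν).real (spannedEvent I l b))
    (hq : ∀ i ∈ I, ∀ b, (siteLaw d ν).real (spannedEvent (I.erase i) l b)ᶜ ≤ q) :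
    (siteLaw d ν).real (spannedEvent I n a)ᶜ
      ≤ (1 - p) ^ l + d * (n * (n - l + 1 : ℕ) ^ d) * q := by
  classical
  obtain ⟨i, hi⟩ := hI
  have hln' : l ≤ n := (Nat.le_mul_self l).trans hln
  let s : ℕ → Site d := fun m => a + Pi.single i ((m : ℤ) * l)
  have hs : ∀ m, m < l → ∀ j, if j ∈ I then a j ≤ s m j ∧ s m j + l ≤ a j + n
      else s m j = a j := by
    intro m hm j
    by_cases hji : j = i
    · subst hji
      simp only [hi, if_true, s, Pi.add_apply, Pi.single_eq_same]
      have : (m + 1) * l ≤ n := le_trans (Nat.mul_le_mul_right l hm) hln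
      have h' : ((m : ℤ) + 1) * l ≤ n := by exact_mod_cast this
      constructor
      · nlinarith [mul_nonneg (Int.natCast_nonneg m) (Int.natCast_nonneg l)]
      · linarith
    · simp [s, hji]
      intro; exact_mod_cast hln'
  have hsub : (spannedEvent I n a)ᶜ ⊆
      (⋂ m ∈ Finset.range l, (spannedEvent I l (s m))ᶜ) ∪ (facesEvent I n l a)ᶜ := by
    intro η hη
    by_contra hc
    simp only [Set.mem_union, Set.mem_iInter, not_or, Set.mem_compl_iff, not_not,
      Finset.mem_range, not_forall] at hc
    obtain ⟨⟨m, hm, hseed⟩, hF⟩ := hc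
    simp only [facesEvent, Set.mem_iInter] at hF
    exact hη (spanned_of_seed hl hln' (hs m hm) hseed fun i hi b hb _ => hF i hi b hb)
  have hdisj : ∀ m ∈ Finset.range l, ∀ m' ∈ Finset.range l, m ≠ m' →
      Disjoint (cube I l (s m)) (cube I l (s m')) := by
    intro m _ m' _ hmm
    rw [Finset.disjoint_left]
    intro x hx hx'
    rw [mem_cube] at hx hx'
    have h1 := hx i
    have h2 := hx' i
    simp only [s, side, hi, if_true, Pi.add_apply, Pi.single_eq_same] at h1 h2
    rcases lt_or_gt_of_ne hmm with h | h
    · have : ((m : ℤ) + 1) * l ≤ m' * l := by exact_mod_cast Nat.mul_le_mul_right l h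
      linarith
    · have : ((m' : ℤ) + 1) * l ≤ m * l := by exact_mod_cast Nat.mul_le_mul_right l h
      linarith
  refine (measureReal_mono hsub).trans ((measureReal_union_le _ _).trans (add_le_add ?_
    (measureReal_compl_facesEvent_le ν hln' a hq0 hq)))
  rw [LocalOn.measureReal_biInter ν (S := fun m => cube I l (s m)) (Finset.range l)
    (fun m _ => (localOn_spannedEvent I l (s m)).compl) hdisj]
  calc _ ≤ ∏ _m ∈ Finset.range l, (1 - p) := by
        refine Finset.prod_le_prod (fun _ _ => measureReal_nonneg) fun m _ => ?_
        rw [probReal_compl_eq_one_sub (localOn_spannedEvent I l (s m)).measurableSet]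
        linarith [hp (s m)]
    _ = _ := by simp

/-- The probability that a cube is not spanned decays faster than any power of its side,
uniformly in its position. -/
def RapidDecay (I : Finset (Fin d)) : Prop :=
  ∀ k : ℕ, ∃ C : ℝ, ∀ (n : ℕ) (a : Site d),
    (siteLaw d ν).real (spannedEvent I n a)ᶜ * (n : ℝ) ^ k ≤ C

theorem exists_uniform_decay {I : Finset (Fin d)} (h : ∀ i ∈ I, RapidDecay ν (I.erase i)) (k : ℕ) :
    ∃ C : ℝ, 0 ≤ C ∧ ∀ i ∈ I, ∀ (n : ℕ) (a : Site d),
      (siteLaw d ν).real (spannedEvent (I.erase i) n a)ᶜ * (n : ℝ) ^ k ≤ C := by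
  choose! C hC using fun i hi => h i hi k
  refine ⟨∑ i ∈ I, |C i|, Finset.sum_nonneg fun _ _ => abs_nonneg _, fun i hi n a => ?_⟩
  exact (hC i hi n a).trans ((le_abs_self _).trans
    (Finset.single_le_sum (f := fun i => |C i|) (fun _ _ => abs_nonneg _) hi))

/-- Spanning has a probability bounded below uniformly in the size of the cube. -/
theorem exists_le_measureReal_spannedEvent (hν : 0 < ν.real {true}) {I : Finset (Fin d)}
    (h : ∀ i ∈ I, RapidDecay ν (I.erase i)) :
    ∃ p : ℝ, 0 < p ∧ ∃ l₀ : ℕ, ∀ l, l₀ ≤ l → ∀ a : Site d,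
      p ≤ (siteLaw d ν).real (spannedEvent I l a) := by
  -- Growing from side `l` to `l + 1` fails with probability of order `l * l⁻⁴`. A bound by `1 / (l
  -- + 1) ^ 2` is wanted, and the spare power of `l` absorbs the constants once `l ≥ l₀`.
  obtain ⟨C, hC0, hC⟩ := exists_uniform_decay ν h 4
  obtain ⟨l₀, hl₀⟩ := exists_nat_gt (d * (2 ^ d * (2 ^ 3 * C)) + 1 : ℝ)
  have hbig : (1 : ℝ) < l₀ := by
    have : 0 ≤ d * (2 ^ d * (2 ^ 3 * C)) := by positivity
    linarith
  have hbig' : 1 < l₀ := by exact_mod_cast hbig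
  have hνle : ν.real {true} ≤ 1 := measureReal_le_one
  set P : ℝ := ν.real {true} ^ (l₀ ^ d)
  have hP : 0 < P := by positivity
  have hbase : ∀ a, P ≤ (siteLaw d ν).real (spannedEvent I l₀ a) := by
    intro a
    have h1 : {η : Site d → Bool | ∀ x ∈ cube I l₀ a, η x = true} ⊆ spannedEvent I l₀ a :=
      fun η hη => spanned_of_subset hη
    refine le_trans ?_ (measureReal_mono h1)
    rw [measureReal_forall_mem_eq]
    refine pow_le_pow_of_le_one hν.le hνle ?_
    rw [cube, Fintype.card_piFinset]
    calc _ ≤ ∏ _j : Fin d, l₀ := Finset.prod_le_prod' fun j _ => by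
          simp only [Int.card_Ico, side]; split_ifs <;> (simp; try omega)
      _ = _ := by simp
  refine ⟨P / 2, by positivity, l₀, ?_⟩
  -- The factors `1 - 1 / (l + 1) ^ 2 = l * (l + 2) / (l + 1) ^ 2` telescope, which gives the
  -- invariant this form. At `l = l₀` it equals `P`, and it never falls below `P / 2`.
  have key : ∀ l, l₀ ≤ l → ∀ a : Site d, P * (l₀ / (l₀ + 1)) * ((l + 1) / l)
      ≤ (siteLaw d ν).real (spannedEvent I l a) := by
    intro l hl
    induction l, hl using Nat.le_induction with
    | base =>
      intro a
      convert hbase a using 1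
      field_simp
    | succ l hl ih =>
      intro a
      have hlpos : (1 : ℝ) < l := lt_of_lt_of_le hbig (by exact_mod_cast hl)
      have hq : ∀ i ∈ I, ∀ b, (siteLaw d ν).real (spannedEvent (I.erase i) l b)ᶜ
          ≤ C / (l : ℝ) ^ 4 := fun i hi b => by
        rw [le_div_iff₀ (by positivity)]
        exact hC i hi l b
      have h1 := measureReal_spannedEvent_mul_le ν (by omega) (Nat.le_succ l) a
        (by positivity) hq
      have h2 : (d : ℝ) * ((l + 1 : ℕ) * ((l + 1 - l + 1 : ℕ) : ℝ) ^ d) * (C / (l : ℝ) ^ 4)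
          ≤ 1 / ((l : ℝ) + 1) ^ 2 := by
        have e1 : l + 1 - l + 1 = 2 := by omega
        rw [e1, mul_div_assoc', div_le_div_iff₀ (by positivity) (by positivity)]
        have h3 : ((l : ℝ) + 1) ^ 3 ≤ 2 ^ 3 * l ^ 3 := by
          rw [← mul_pow]; gcongr; linarith
        have h4 : (d * (2 ^ d * (2 ^ 3 * C)) : ℝ) ≤ l := by
          have : (l₀ : ℝ) ≤ l := by exact_mod_cast hl
          linarith
        push_cast
        calc (d : ℝ) * ((l + 1) * 2 ^ d) * C * ((l : ℝ) + 1) ^ 2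
            = d * (2 ^ d * C) * ((l : ℝ) + 1) ^ 3 := by ring
          _ ≤ d * (2 ^ d * C) * (2 ^ 3 * l ^ 3) := by gcongr
          _ = (d * (2 ^ d * (2 ^ 3 * C))) * l ^ 3 := by ring
          _ ≤ l * l ^ 3 := by gcongr
          _ = 1 * l ^ 4 := by ring
      refine le_trans ?_ h1
      have h5 : 1 - 1 / ((l : ℝ) + 1) ^ 2 = l * (l + 2) / (l + 1) ^ 2 := by
        field_simp; ring
      calc P * (l₀ / (l₀ + 1)) * (((l + 1 : ℕ) + 1) / (l + 1 : ℕ))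
          = P * (l₀ / (l₀ + 1)) * ((l + 1) / l) * (1 - 1 / ((l : ℝ) + 1) ^ 2) := by
            rw [h5]; push_cast; field_simp; ring
        _ ≤ (siteLaw d ν).real (spannedEvent I l a) * (1 - 1 / ((l : ℝ) + 1) ^ 2) := by
            refine mul_le_mul_of_nonneg_right (ih a) ?_
            rw [h5]; positivity
        _ ≤ _ := by
            refine mul_le_mul_of_nonneg_left ?_ measureReal_nonneg
            linarith
  intro l hl a
  refine le_trans ?_ (key l hl a)
  have hlpos : (1 : ℝ) < l := lt_of_lt_of_le hbig (by exact_mod_cast hl)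
  have h1 : (1 : ℝ) / 2 ≤ l₀ / (l₀ + 1) := by
    rw [div_le_div_iff₀ (by norm_num) (by positivity)]; linarith
  have h2 : (1 : ℝ) ≤ (l + 1) / l := by rw [le_div_iff₀ (by positivity)]; linarith
  calc P / 2 = P * (1 / 2) * 1 := by ring
    _ ≤ _ := by gcongr

/-- Take `l` of order `√n`. Either `l` independent seeds all fail, which is exponentially unlikely
in `l`, or one of polynomially many faces of side `l` fails, which the rapid decay in one dimension
less makes unlikely. -/
theorem rapidDecay_step (hν : 0 < ν.real {true}) {I : Finset (Fin d)} (hI : I.Nonempty)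
    (h : ∀ i ∈ I, RapidDecay ν (I.erase i)) : RapidDecay ν I := by
  obtain ⟨p, hp0, l₀, hp⟩ := exists_le_measureReal_spannedEvent ν hν h
  have hp1 : p ≤ 1 := (hp l₀ le_rfl 0).trans measureReal_le_one
  intro k
  -- There are at most `d * n ^ (d + 1)` faces, and a further `n ^ k` must be beaten; in terms of
  -- `l` this is the exponent `2 * (d + 1 + k)`.
  obtain ⟨C, hC0, hC⟩ := exists_uniform_decay ν h (2 * (d + 1 + k))
  obtain ⟨B, hB⟩ := (tendsto_pow_const_mul_const_pow_of_abs_lt_one (2 * k) (r := 1 - p)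
    (by rw [abs_lt]; constructor <;> linarith)).bddAbove_range
  have hB' : ∀ l : ℕ, (l : ℝ) ^ (2 * k) * (1 - p) ^ l ≤ B := fun l => hB ⟨l, rfl⟩
  -- The first entry covers sides too small for `√n` to exceed `l₀`, where the trivial bound on the
  -- probability is used.
  refine ⟨max ((((l₀ + 1) ^ 2 : ℕ) : ℝ) ^ k) (4 ^ k * B + d * (4 ^ (d + 1 + k) * C)), fun n a => ?_⟩
  by_cases hn : n < (l₀ + 1) ^ 2
  · refine le_trans ?_ (le_max_left _ _)
    calc _ ≤ 1 * (n : ℝ) ^ k := by gcongr; exact measureReal_le_one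
      _ ≤ _ := by rw [one_mul]; gcongr
  refine le_trans ?_ (le_max_right _ _)
  set l := Nat.sqrt n with hldef
  have hl1 : l₀ + 1 ≤ l := by rw [hldef, Nat.le_sqrt']; omega
  have hln : l * l ≤ n := Nat.sqrt_le n
  have hnl : n ≤ 4 * l ^ 2 := by
    have := Nat.sqrt_le_add n
    nlinarith
  have hnl' : (n : ℝ) ≤ 4 * l ^ 2 := by exact_mod_cast hnl
  have hl0 : (0 : ℝ) < l := by exact_mod_cast (by omega : 0 < l)
  have hq : ∀ i ∈ I, ∀ b, (siteLaw d ν).real (spannedEvent (I.erase i) l b)ᶜ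
      ≤ C / (l : ℝ) ^ (2 * (d + 1 + k)) := fun i hi b => by
    rw [le_div_iff₀ (by positivity)]
    exact hC i hi l b
  have h1 := measureReal_compl_spannedEvent_le ν hI (by omega) hln a (by positivity)
    (hp l (by omega)) hq
  have hl2 := Nat.le_mul_self l
  have h2 : ((n - l + 1 : ℕ) : ℝ) ≤ n := by exact_mod_cast (by omega : n - l + 1 ≤ n)
  calc _ ≤ ((1 - p) ^ l + d * (n * (n - l + 1 : ℕ) ^ d) * (C / (l : ℝ) ^ (2 * (d + 1 + k))))
        * (n : ℝ) ^ k := by gcongr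
    _ ≤ ((1 - p) ^ l + d * (n * (n : ℝ) ^ d) * (C / (l : ℝ) ^ (2 * (d + 1 + k))))
        * (n : ℝ) ^ k := by gcongr
    _ = (n : ℝ) ^ k * (1 - p) ^ l
        + d * ((n : ℝ) ^ (d + 1 + k) * (C / (l : ℝ) ^ (2 * (d + 1 + k)))) := by ring
    _ ≤ (4 * l ^ 2 : ℝ) ^ k * (1 - p) ^ l
        + d * ((4 * l ^ 2 : ℝ) ^ (d + 1 + k) * (C / (l : ℝ) ^ (2 * (d + 1 + k)))) := by
        have : 0 ≤ 1 - p := by linarith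
        gcongr
    _ = 4 ^ k * ((l : ℝ) ^ (2 * k) * (1 - p) ^ l) + d * (4 ^ (d + 1 + k) * C) := by
        rw [mul_pow, mul_pow, ← pow_mul, ← pow_mul]
        field_simp
    _ ≤ _ := by
        gcongr
        exact hB' l

theorem rapidDecay (hν : 0 < ν.real {true}) (I : Finset (Fin d)) : RapidDecay ν I := by
  induction I using Finset.strongInduction with
  | H I ih =>
    rcases I.eq_empty_or_nonempty with rfl | hI
    · intro k
      refine ⟨0, fun n a => ?_⟩
      have : spannedEvent (∅ : Finset (Fin d)) n a = Set.univ :=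
        Set.eq_univ_of_forall fun η => spanned_empty _ _
      simp [this]
    · exact rapidDecay_step ν hν hI fun i hi => ih _ (Finset.erase_ssubset hi)

end Spanning

/-! ### Spanned cubes with open corners -/

section GoodCubes

variable {d : ℕ}

/-- The corners of the cube of radius `k` around `c`. -/
def corners (k : ℕ) (c : Site d) : Finset (Site d) :=
  Fintype.piFinset fun j => {c j - k, c j + k}

theorem mem_corners {k : ℕ} {c x : Site d} :
    x ∈ corners k c ↔ ∀ j, x j = c j - k ∨ x j = c j + k := by
  simp [corners]

/-- The cube of radius `k` around `c`. -/
noncomputable def centeredCube (k : ℕ) (c : Site d) : Finset (Site d) :=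
  cube Finset.univ (2 * k + 1) fun j => c j - k

theorem mem_centeredCube {k : ℕ} {c x : Site d} :
    x ∈ centeredCube k c ↔ ∀ j, c j - k ≤ x j ∧ x j ≤ c j + k := by
  rw [centeredCube, mem_cube]
  refine forall_congr' fun j => ?_
  simp [side]
  omega

theorem centeredCube_mono {k m : ℕ} (h : k ≤ m) (c : Site d) :
    centeredCube k c ⊆ centeredCube m c := by
  intro x hx
  rw [mem_centeredCube] at hx ⊢
  intro j
  have := hx j
  omega

theorem corners_subset {k : ℕ} (c : Site d) : corners k c ⊆ centeredCube k c := by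
  intro x hx
  rw [mem_corners] at hx
  rw [mem_centeredCube]
  intro j
  have := hx j
  omega

theorem card_corners_le (k : ℕ) (c : Site d) : (corners k c).card ≤ 2 ^ d := by
  rw [corners, Fintype.card_piFinset]
  calc _ ≤ ∏ _j : Fin d, 2 := Finset.prod_le_prod' fun j _ => Finset.card_le_two
    _ = _ := by simp

/-- This makes the corners of concentric cubes independent trials. A direction must exist: in
dimension zero all the corner sets coincide. -/
theorem disjoint_corners (hd : 1 ≤ d) {k m : ℕ} (h : k ≠ m) (c : Site d) :
    Disjoint (corners k c) (corners m c) := by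
  rw [Finset.disjoint_left]
  intro x hx hx'
  rw [mem_corners] at hx hx'
  have h1 := hx ⟨0, hd⟩
  have h2 := hx' ⟨0, hd⟩
  omega

/-- Some cube around `c` of radius between `n` and `2 n` is spanned by `A` and has its corners
in `A`. -/
def HasGoodCube (A : Set (Site d)) (n : ℕ) (c : Site d) : Prop :=
  ∃ k, n ≤ k ∧ k < 2 * n ∧ (∀ x ∈ corners k c, x ∈ A) ∧ Spanned A Finset.univ (centeredCube k c)

/-- The event that the open vertices have a good cube around `c`. -/
def goodCubeEvent (n : ℕ) (c : Site d) : Set (Site d → Bool) :=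
  {η | HasGoodCube {x | η x = true} n c}

theorem localOn_goodCubeEvent (n : ℕ) (c : Site d) :
    LocalOn (centeredCube (2 * n) c) (goodCubeEvent n c) := by
  rintro η η' h ⟨k, hnk, hk, hc, hs⟩
  have hsub := centeredCube_mono hk.le c
  refine ⟨k, hnk, hk, fun x hx => ?_, ?_⟩
  · have := hc x hx
    simpa [h x (hsub (corners_subset c hx))] using this
  · exact (localOn_spannedEvent _ _ _).mono hsub η η' h hs

/-- The `n` radii give `n` independent chances of open corners, each of probability at least `r`. By
rapid decay with exponent two, all these cubes are spanned except with probability at most `n * (C /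
n ^ 2)`. Corners and spanning need not be independent of each other. -/
theorem exists_measureReal_compl_goodCubeEvent_le (hd : 1 ≤ d) (ν : Measure Bool)
    [IsProbabilityMeasure ν] (hν : 0 < ν.real {true}) {δ : ℝ} (hδ : 0 < δ) :
    ∃ n : ℕ, 1 ≤ n ∧ ∀ c : Site d, (siteLaw d ν).real (goodCubeEvent n c)ᶜ ≤ δ := by
  obtain ⟨C, hC⟩ := rapidDecay (d := d) ν hν Finset.univ 2
  have hC0 : 0 ≤ C := le_trans (by positivity) (hC 0 0)
  have hν1 : ν.real {true} ≤ 1 := measureReal_le_one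
  set r : ℝ := ν.real {true} ^ 2 ^ d
  have hr : 0 < r := by positivity
  have hr1 : r ≤ 1 := pow_le_one₀ hν.le hν1
  have hlim : Tendsto (fun n : ℕ => (1 - r) ^ n + C / n) atTop (𝓝 (0 + 0)) :=
    (tendsto_pow_atTop_nhds_zero_of_lt_one (by linarith) (by linarith)).add
      (tendsto_const_div_atTop_nhds_zero_nat C)
  rw [add_zero] at hlim
  obtain ⟨n, hn1, hn⟩ := ((eventually_ge_atTop 1).and (hlim.eventually (gt_mem_nhds hδ))).exists
  refine ⟨n, hn1, fun c => le_trans ?_ hn.le⟩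
  have hn0 : (0 : ℝ) < n := by exact_mod_cast hn1
  let K : ℕ → Set (Site d → Bool) := fun k => {η | ∀ x ∈ corners k c, η x = true}
  let U : ℕ → Set (Site d → Bool) := fun k =>
    spannedEvent Finset.univ (2 * k + 1) fun j => c j - k
  have hsub : (goodCubeEvent n c)ᶜ ⊆
      (⋂ k ∈ Finset.Ico n (2 * n), (K k)ᶜ) ∪ ⋃ k ∈ Finset.Ico n (2 * n), (U k)ᶜ := by
    intro η hη
    by_contra hc
    simp only [Set.mem_union, Set.mem_iInter, Set.mem_iUnion, not_or, Set.mem_compl_iff,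
      not_forall, not_not, not_exists, Finset.mem_Ico] at hc
    obtain ⟨⟨k, hk, hkK⟩, hU⟩ := hc
    exact hη ⟨k, hk.1, hk.2, hkK, hU k hk⟩
  refine (measureReal_mono hsub).trans ((measureReal_union_le _ _).trans (add_le_add ?_ ?_))
  · rw [LocalOn.measureReal_biInter ν (S := fun k => corners k c) _
      (fun k _ => (localOn_forall_mem_eq _ _).compl)
      (fun k _ l _ hkl => disjoint_corners hd hkl c)]
    calc _ ≤ ∏ _k ∈ Finset.Ico n (2 * n), (1 - r) := by
          refine Finset.prod_le_prod (fun _ _ => measureReal_nonneg) fun k _ => ?_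
          rw [probReal_compl_eq_one_sub (localOn_forall_mem_eq _ _).measurableSet,
            measureReal_forall_mem_eq]
          have := pow_le_pow_of_le_one hν.le hν1 (card_corners_le k c)
          linarith
      _ = (1 - r) ^ n := by
          rw [Finset.prod_const, Nat.card_Ico]; congr 1; omega
  · refine (measureReal_biUnion_finset_le _ _).trans ?_
    calc _ ≤ ∑ _k ∈ Finset.Ico n (2 * n), C / (n : ℝ) ^ 2 := by
          refine Finset.sum_le_sum fun k hk => ?_
          rw [Finset.mem_Ico] at hk
          rw [le_div_iff₀ (by positivity)]
          refine le_trans ?_ (hC (2 * k + 1) fun j => c j - k)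
          refine mul_le_mul_of_nonneg_left ?_ measureReal_nonneg
          gcongr
          omega
      _ = C / n := by
          rw [Finset.sum_const, Nat.card_Ico, nsmul_eq_mul, show 2 * n - n = n by omega]
          field_simp

end GoodCubes

/-! ### Absence of percolation of rare local events -/

section Peierls

variable {d : ℕ}

/-- The nearest neighbors of `z`. -/
def nbrs (z : Site d) : Finset (Site d) :=
  Finset.univ.image (fun i => z + Pi.single i 1) ∪ Finset.univ.image (fun i => z - Pi.single i 1)

theorem mem_nbrs {z y : Site d} : y ∈ nbrs z ↔ (lattice d).Adj z y := by
  rw [lattice_adj_iff]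
  simp only [nbrs, Finset.mem_union, Finset.mem_image, Finset.mem_univ, true_and]
  constructor
  · rintro (⟨i, rfl⟩ | ⟨i, rfl⟩)
    exacts [⟨i, Or.inl rfl⟩, ⟨i, Or.inr rfl⟩]
  · rintro ⟨i, rfl | rfl⟩
    exacts [Or.inl ⟨i, rfl⟩, Or.inr ⟨i, rfl⟩]

theorem card_nbrs_le (z : Site d) : (nbrs z).card ≤ 2 * d := by
  refine (Finset.card_union_le _ _).trans ?_
  have h1 := Finset.card_image_le (s := Finset.univ) (f := fun i : Fin d => z + Pi.single i (1 : ℤ))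
  have h2 := Finset.card_image_le (s := Finset.univ) (f := fun i : Fin d => z - Pi.single i (1 : ℤ))
  simp only [Finset.card_univ, Fintype.card_fin] at h1 h2
  omega

/-- The nearest-neighbor walks with `n` steps from `z`, as lists of vertices. -/
def walks : ℕ → Site d → Finset (List (Site d))
  | 0, z => {[z]}
  | n + 1, z => (nbrs z).biUnion fun y => (walks n y).image (List.cons z)

theorem card_walks_le (n : ℕ) (z : Site d) : (walks n z).card ≤ (2 * d) ^ n := by
  induction n generalizing z with
  | zero => simp [walks]
  | succ n ih =>
    rw [walks, pow_succ']
    refine (Finset.card_biUnion_le_card_mul _ _ ((2 * d) ^ n) fun y _ =>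
      Finset.card_image_le.trans (ih y)).trans ?_
    exact Nat.mul_le_mul_right _ (card_nbrs_le z)

theorem mem_walks {n : ℕ} {z : Site d} {l : List (Site d)} (hl : l.IsChain (lattice d).Adj)
    (hz : l.head? = some z) (hn : l.length = n + 1) : l ∈ walks n z := by
  induction n generalizing z l with
  | zero =>
    obtain ⟨a, rfl⟩ := List.length_eq_one_iff.1 hn
    simp at hz
    simp [walks, hz]
  | succ n ih =>
    match l, hl, hz, hn with
    | a :: b :: l, hl, hz, hn =>
      simp only [List.head?_cons, Option.some.injEq] at hz
      subst hz
      rw [List.isChain_cons_cons] at hl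
      simp only [walks, Finset.mem_biUnion, Finset.mem_image]
      exact ⟨b, mem_nbrs.2 hl.1, _, ih hl.2 rfl (by simpa using hn), rfl⟩

variable {α κ : Type*} [Finite α] [MeasurableSpace α] [MeasurableSingletonClass α] [Inhabited α]
  (ν : Measure α) [IsProbabilityMeasure ν] [Fintype κ] [DecidableEq κ]

/-- By pigeonhole some color occurs at least `m` times in `F`, and the events of one color are
independent. -/
theorem measureReal_forall_mem_finset_le {S : Site d → Finset (Site d)}
    {B : Site d → Set (Site d → α)} (hB : ∀ z, LocalOn (S z) (B z)) (col : Site d → κ)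
    (hcol : ∀ z z', z ≠ z' → col z = col z' → Disjoint (S z) (S z')) {δ : ℝ}
    (hδ1 : δ ≤ 1)
    (hP : ∀ z, (Measure.infinitePi fun _ : Site d => ν).real (B z) ≤ δ) (F : Finset (Site d))
    {m : ℕ} (hm : Fintype.card κ * m ≤ F.card) (hκ : Nonempty κ) :
    (Measure.infinitePi fun _ : Site d => ν).real {η | ∀ z ∈ F, η ∈ B z} ≤ δ ^ m := by
  have hδ0 : 0 ≤ δ := measureReal_nonneg.trans (hP 0)
  obtain ⟨c, -, hc⟩ := Finset.exists_le_card_fiber_of_mul_le_card_of_maps_to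
    (s := F) (t := (Finset.univ : Finset κ)) (f := col) (n := m) (fun _ _ => Finset.mem_univ _)
    Finset.univ_nonempty (by simpa using hm)
  set G := F.filter fun z => col z = c
  have hsub : {η | ∀ z ∈ F, η ∈ B z} ⊆ ⋂ z ∈ G, B z := by
    intro η hη
    simp only [Set.mem_iInter]
    exact fun z hz => hη z (Finset.mem_of_mem_filter z hz)
  refine (measureReal_mono hsub).trans ?_
  rw [LocalOn.measureReal_biInter ν (S := S) G (fun z _ => hB z)]
  · calc _ ≤ ∏ _z ∈ G, δ := Finset.prod_le_prod (fun _ _ => measureReal_nonneg) fun z _ => hP z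
      _ = δ ^ G.card := by simp
      _ ≤ _ := pow_le_pow_of_le_one hδ0 hδ1 hc
  · intro z hz z' hz' hne
    exact hcol z z' hne ((Finset.mem_filter.1 hz).2.trans (Finset.mem_filter.1 hz').2.symm)

/-- Peierls argument: at most `(2 * d) ^ (#κ * m)` paths with `#κ * m` vertices start at `z`, and
each is entirely bad with probability at most `δ ^ m`. The product tends to zero as `m` grows. -/
theorem ae_forall_exists_no_bad_path {S : Site d → Finset (Site d)}
    {B : Site d → Set (Site d → α)} (hB : ∀ z, LocalOn (S z) (B z)) (col : Site d → κ)
    (hcol : ∀ z z', z ≠ z' → col z = col z' → Disjoint (S z) (S z')) {δ : ℝ} (hδ1 : δ ≤ 1)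
    (hδ : (2 * d : ℝ) ^ Fintype.card κ * δ < 1) (hd : 1 ≤ d)
    (hP : ∀ z, (Measure.infinitePi fun _ : Site d => ν).real (B z) ≤ δ) :
    ∀ᵐ η ∂(Measure.infinitePi fun _ : Site d => ν), ∀ z, ∃ L : ℕ, ∀ l : List (Site d),
      l.IsChain (lattice d).Adj → l.Nodup → l.head? = some z → l.length = L + 1 →
        ¬ ∀ x ∈ l, η ∈ B x := by
  have hδ0 : 0 ≤ δ := measureReal_nonneg.trans (hP 0)
  have hκ : Nonempty κ := ⟨col 0⟩
  have hK : 1 ≤ Fintype.card κ := Fintype.card_pos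
  have hd' : (1 : ℝ) ≤ 2 * d := by
    have : (1 : ℝ) ≤ d := by exact_mod_cast hd
    linarith
  rw [ae_all_iff]
  intro z
  rw [ae_iff]
  set μ := Measure.infinitePi fun _ : Site d => ν
  have : IsProbabilityMeasure μ := inferInstanceAs (IsProbabilityMeasure (Measure.infinitePi _))
  set E := {η : Site d → α | ¬ ∃ L : ℕ, ∀ l : List (Site d),
      l.IsChain (lattice d).Adj → l.Nodup → l.head? = some z → l.length = L + 1 →
        ¬ ∀ x ∈ l, η ∈ B x}
  set r : ℝ := (2 * d : ℝ) ^ Fintype.card κ * δ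
  have hr0 : 0 ≤ r := by positivity
  have hbound : ∀ m : ℕ, 1 ≤ m → μ.real E ≤ r ^ m := by
    intro m hm
    have hpos : 1 ≤ Fintype.card κ * m := Nat.mul_pos hK hm
    -- A walk with `L` steps has `L + 1 = #κ * m` vertices, just enough for the pigeonhole count
    -- `m`.
    set L := Fintype.card κ * m - 1
    have hsub : E ⊆ ⋃ l ∈ (walks L z).filter List.Nodup, {η | ∀ x ∈ l.toFinset, η ∈ B x} := by
      intro η hη
      simp only [E, not_exists, not_forall, not_not, Set.mem_ofPred_eq] at hη
      obtain ⟨l, hl, hnd, hz, hlen, hx⟩ := hη L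
      simp only [Set.mem_iUnion, Finset.mem_filter]
      exact ⟨l, ⟨mem_walks hl hz hlen, hnd⟩, fun x hx' => hx x (List.mem_toFinset.1 hx')⟩
    refine (measureReal_mono hsub (measure_ne_top _ _)).trans
      ((measureReal_biUnion_finset_le _ _).trans ?_)
    calc _ ≤ ∑ _l ∈ (walks L z).filter List.Nodup, δ ^ m := by
          refine Finset.sum_le_sum fun l hl => ?_
          rw [Finset.mem_filter] at hl
          refine measureReal_forall_mem_finset_le ν hB col hcol hδ1 hP _ ?_ hκ
          rw [List.toFinset_card_of_nodup hl.2]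
          have : ∀ (n : ℕ) (z : Site d), ∀ l ∈ walks n z, l.length = n + 1 := by
            intro n
            induction n with
            | zero => simp [walks]
            | succ n ih =>
              intro z l hl
              simp only [walks, Finset.mem_biUnion, Finset.mem_image] at hl
              obtain ⟨y, -, l', hl', rfl⟩ := hl
              simp [ih y l' hl']
          rw [this L z l hl.1]
          omega
      _ ≤ ((2 * d : ℝ) ^ (Fintype.card κ * m)) * δ ^ m := by
          rw [Finset.sum_const, nsmul_eq_mul]
          gcongr
          calc ((((walks L z).filter List.Nodup).card : ℕ) : ℝ) ≤ (((2 * d) ^ L : ℕ) : ℝ) := by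
                exact_mod_cast (Finset.card_filter_le _ _).trans (card_walks_le L z)
            _ = (2 * d : ℝ) ^ L := by push_cast; rfl
            _ ≤ _ := pow_le_pow_right₀ hd' (by omega)
      _ = r ^ m := by rw [pow_mul, ← mul_pow]
  have h0 : μ.real E ≤ 0 := by
    refine ge_of_tendsto (tendsto_pow_atTop_nhds_zero_of_lt_one hr0 hδ) ?_
    filter_upwards [eventually_ge_atTop 1] with m hm using hbound m hm
  exact (measureReal_eq_zero_iff).1 (le_antisymm h0 measureReal_nonneg)


theorem abs_sub_le_length {B : Set (Site d)} {z w : B} (p : ((lattice d).induce B).Walk z w)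
    (i : Fin d) : |(z : Site d) i - (w : Site d) i| ≤ p.length := by
  induction p with
  | nil => simp
  | @cons u v w h p ih =>
    have h1 : ∑ j, |(u : Site d) j - (v : Site d) j| = 1 := h
    have h2 : |(u : Site d) i - (v : Site d) i| ≤ 1 := by
      rw [← h1]
      exact Finset.single_le_sum (f := fun j => |(u : Site d) j - (v : Site d) j|)
        (fun _ _ => abs_nonneg _) (Finset.mem_univ i)
    simp only [SimpleGraph.Walk.length_cons, Nat.cast_add, Nat.cast_one]
    have h3 := abs_sub_le ((u : Site d) i) ((v : Site d) i) ((w : Site d) i)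
    omega

/-- The index of the block of side `n` containing `x`. -/
def blockIndex (n : ℕ) (x : Site d) : Site d := fun i => x i / n

theorem blockIndex_adj {n : ℕ} (hn : 1 ≤ n) {x y : Site d} (h : (lattice d).Adj x y) :
    blockIndex n x = blockIndex n y ∨ (lattice d).Adj (blockIndex n x) (blockIndex n y) := by
  have hn' : (0 : ℤ) < n := by exact_mod_cast hn
  have key : ∀ x : Site d, ∀ i, blockIndex n x = blockIndex n (x + Pi.single i 1) ∨
      (lattice d).Adj (blockIndex n x) (blockIndex n (x + Pi.single i 1)) := by
    intro x i
    have h1 : (x i + 1) / n = x i / n ∨ (x i + 1) / n = x i / n + 1 := by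
      have e1 := Int.ediv_mul_le (x i) hn'.ne'
      have e2 := Int.lt_ediv_add_one_mul_self (x i) hn'
      have e3 := Int.ediv_mul_le (x i + 1) hn'.ne'
      have e4 := Int.lt_ediv_add_one_mul_self (x i + 1) hn'
      have e5 : x i / n ≤ (x i + 1) / n := Int.ediv_le_ediv hn' (by omega)
      have e6 : (x i + 1) / n ≤ x i / n + 1 := by
        by_contra! hc
        have := mul_le_mul_of_nonneg_right (show x i / n + 2 ≤ (x i + 1) / n by omega) hn'.le
        nlinarith
      omega
    rcases h1 with h1 | h1
    · left
      funext j
      by_cases hj : j = i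
      · subst hj; simp [blockIndex, h1]
      · simp [blockIndex, hj]
    · right
      rw [lattice_adj_iff]
      refine ⟨i, Or.inl ?_⟩
      funext j
      by_cases hj : j = i
      · subst hj; simp [blockIndex, h1]
      · simp [blockIndex, hj]
  rw [lattice_adj_iff] at h
  obtain ⟨i, rfl | rfl⟩ := h
  · exact key x i
  · have := key (x - Pi.single i 1) i
    rw [sub_add_cancel] at this
    exact this.imp Eq.symm SimpleGraph.Adj.symm

/-- If a percolating set meets only blocks in `B`, then `B` contains arbitrarily long
self-avoiding paths from some vertex. -/
theorem Percolates.exists_path {C B : Set (Site d)} {n : ℕ} (hn : 1 ≤ n) (hC : Percolates C)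
    (hB : ∀ x ∈ C, blockIndex n x ∈ B) :
    ∃ z, ∀ L : ℕ, ∃ l : List (Site d), l.IsChain (lattice d).Adj ∧ l.Nodup ∧ l.head? = some z ∧
      l.length = L + 1 ∧ ∀ x ∈ l, x ∈ B := by
  have hn' : (0 : ℤ) < n := by exact_mod_cast hn
  obtain ⟨c, hc⟩ := hC
  obtain ⟨x₀, hx₀⟩ := hc.nonempty
  refine ⟨blockIndex n x₀, fun L => ?_⟩
  let φ : C → B := fun x => ⟨blockIndex n x, hB x x.2⟩
  have hreach : ∀ x y : C, ((lattice d).induce C).Walk x y →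
      ((lattice d).induce B).Reachable (φ x) (φ y) := by
    intro x y p
    induction p with
    | nil => exact SimpleGraph.Reachable.refl _
    | @cons u v w h p ih =>
      refine SimpleGraph.Reachable.trans ?_ ih
      have h' : (lattice d).Adj u v := h
      rcases blockIndex_adj hn h' with he | ha
      · have : φ u = φ v := Subtype.ext he
        rw [this]
      · exact SimpleGraph.Adj.reachable (G := (lattice d).induce B) (u := φ u) (v := φ v) ha
  -- Otherwise the component would lie in a finite box of blocks.
  obtain ⟨x, hx, hfar⟩ : ∃ x ∈ c.supp, ∃ i : Fin d,
      (L : ℤ) < |blockIndex n (x₀ : Site d) i - blockIndex n (x : Site d) i| := by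
    by_contra! hcon
    refine hc (Set.Finite.subset (s := Subtype.val ⁻¹' (↑(Fintype.piFinset fun i : Fin d =>
      Finset.Icc ((blockIndex n (x₀ : Site d) i - L) * n)
        ((blockIndex n (x₀ : Site d) i + L + 1) * n)) : Set (Site d)))
      ((Finset.finite_toSet _).preimage Subtype.val_injective.injOn) fun x hx => ?_)
    simp only [Set.mem_preimage, Finset.mem_coe, Fintype.mem_piFinset, Finset.mem_Icc]
    intro i
    have h1 := abs_le.1 (hcon x hx i)
    have e1 := Int.ediv_mul_le ((x : Site d) i) hn'.ne'
    have e2 := Int.lt_ediv_add_one_mul_self ((x : Site d) i) hn'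
    have e3 : blockIndex n (x : Site d) i = (x : Site d) i / n := rfl
    rw [e3] at h1
    constructor
    · exact le_trans (mul_le_mul_of_nonneg_right (by omega) hn'.le) e1
    · exact e2.le.trans (mul_le_mul_of_nonneg_right (by omega) hn'.le)
  obtain ⟨i, hi⟩ := hfar
  have hr : ((lattice d).induce C).Reachable x₀ x := by
    rw [SimpleGraph.ConnectedComponent.mem_supp_iff] at hx hx₀
    exact SimpleGraph.ConnectedComponent.exact (hx₀.trans hx.symm)
  -- A self-avoiding path of blocks is at least as long as its displacement in a coordinate, so it
  -- can be cut to `L + 1` vertices.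
  obtain ⟨p, hp⟩ := (hreach x₀ x hr.some).exists_isPath
  have hlen : (L : ℤ) < p.length := lt_of_lt_of_le hi (abs_sub_le_length p i)
  refine ⟨(p.support.map Subtype.val).take (L + 1), ?_, ?_, ?_, ?_, ?_⟩
  · refine List.IsChain.take ?_ _
    rw [List.isChain_map]
    exact p.isChain_adj_support
  · exact ((hp.support_nodup).map Subtype.val_injective).sublist (List.take_sublist _ _)
  · rw [List.head?_take, if_neg (by omega), List.head?_map, ← p.cons_tail_support]
    rfl
  · rw [List.length_take, List.length_map, SimpleGraph.Walk.length_support]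
    omega
  · intro y hy
    obtain ⟨w, -, rfl⟩ := List.mem_map.1 (List.mem_of_mem_take hy)
    exact w.2

end Peierls

/-! ### Poisson clocks -/

section Clocks

instance : IsProbabilityMeasure (expMeasure 1) := isProbabilityMeasure_expMeasure one_pos

theorem expMeasure_Iic {x : ℝ} (hx : 0 ≤ x) :
    expMeasure 1 (Set.Iic x) = ENNReal.ofReal (1 - Real.exp (-x)) := by
  rw [← ofReal_cdf, cdf_expMeasure_eq one_pos, if_pos hx, one_mul]

theorem expMeasure_Ioi {x : ℝ} (hx : 0 ≤ x) :
    expMeasure 1 (Set.Ioi x) = ENNReal.ofReal (Real.exp (-x)) := by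
  rw [← Set.compl_Iic, prob_compl_eq_one_sub measurableSet_Iic, expMeasure_Iic hx,
    ← ENNReal.ofReal_one, ← ENNReal.ofReal_sub _ (by simpa using hx)]
  congr 1; ring

/-- The time of the ring number `k` of a clock with the given waiting times. -/
def arrival (w : ℕ → ℝ) (k : ℕ) : ℝ := ∑ i ∈ Finset.range (k + 1), w i

theorem measurable_arrival (k : ℕ) : Measurable fun w : ℕ → ℝ => arrival w k := by
  unfold arrival; fun_prop

/-- The law of the waiting times of one clock. -/
noncomputable abbrev waitingLaw : Measure (ℕ → ℝ) := Measure.infinitePi fun _ : ℕ => expMeasure 1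

/-- The waiting times with indices in `J`, the other ones being replaced by zero. -/
noncomputable def truncate (J : Finset ℕ) (w : ℕ → ℝ) (i : ℕ) : ℝ := if i ∈ J then w i else 0

theorem measurable_truncate (J : Finset ℕ) : Measurable (truncate J) := by
  refine measurable_pi_lambda _ fun i => ?_
  unfold truncate
  split_ifs <;> fun_prop

/-- Padding by zeros keeps values in `ℕ → ℝ`, so that `arrival` applies to truncated waits; it is a
measurable function of the finitely many retained coordinates. -/
theorem indepFun_truncate {I J : Finset ℕ} (h : Disjoint I J) :
    IndepFun (truncate I) (truncate J) waitingLaw := by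
  have hi : iIndepFun (fun (i : ℕ) (w : ℕ → ℝ) => w i) waitingLaw :=
    iIndepFun_infinitePi (X := fun _ a => a) fun _ => measurable_id
  have h1 := hi.indepFun_finset I J h fun i => measurable_pi_apply i
  let e : ∀ I : Finset ℕ, (I → ℝ) → ℕ → ℝ := fun I u i => if hi : i ∈ I then u ⟨i, hi⟩ else 0
  have he : ∀ I, Measurable (e I) := fun I => by
    refine measurable_pi_lambda _ fun i => ?_
    simp only [e]
    split_ifs <;> fun_prop
  have h2 := h1.comp (he I) (he J)
  convert h2 using 1 <;>
  · funext w i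
    simp [truncate, e]

theorem arrival_truncate {j k : ℕ} (h : k < j) (w : ℕ → ℝ) :
    arrival (truncate (Finset.range j) w) k = arrival w k :=
  Finset.sum_congr rfl fun i hi => by
    rw [truncate, if_pos]
    rw [Finset.mem_range] at hi ⊢
    omega

/-- The first ring after time `T` is the ring number `j`. -/
def firstAfter (T : ℝ) (j : ℕ) : Set (ℕ → ℝ) := {w | (∀ i < j, arrival w i ≤ T) ∧ T < arrival w j}

theorem measurableSet_firstAfter (T : ℝ) (j : ℕ) : MeasurableSet (firstAfter T j) := by
  have : firstAfter T j = (⋂ i ∈ Set.Iio j, {w | arrival w i ≤ T}) ∩ {w | T < arrival w j} := by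
    ext w; simp [firstAfter]
  rw [this]
  refine (MeasurableSet.biInter (Set.to_countable _) fun i _ => ?_).inter ?_
  · exact measurableSet_le (measurable_arrival i) measurable_const
  · exact measurableSet_lt measurable_const (measurable_arrival j)

theorem disjoint_firstAfter (T : ℝ) : Pairwise (Function.onFun Disjoint (firstAfter T)) := by
  intro i j hij
  rw [Function.onFun, Set.disjoint_left]
  rintro w ⟨h1, h2⟩ ⟨h3, h4⟩
  rcases lt_or_gt_of_ne hij with h | h
  · exact absurd (h3 i h) (not_le.2 h2)
  · exact absurd (h1 j h) (not_le.2 h4)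

/-- Total probability over the index of the first ring after `T`: a bound conditional on each index
is a bound overall. -/
theorem measure_iUnion_firstAfter_inter_le (T : ℝ) (E : ℕ → Set (ℕ → ℝ)) (c : ℝ≥0∞)
    (h : ∀ j, waitingLaw (firstAfter T j ∩ E j) ≤ c * waitingLaw (firstAfter T j)) :
    waitingLaw (⋃ j, firstAfter T j ∩ E j) ≤ c := by
  calc _ ≤ ∑' j, waitingLaw (firstAfter T j ∩ E j) := measure_iUnion_le _
    _ ≤ ∑' j, c * waitingLaw (firstAfter T j) := ENNReal.tsum_le_tsum h
    _ = c * waitingLaw (⋃ j, firstAfter T j) := by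
        rw [ENNReal.tsum_mul_left, measure_iUnion (disjoint_firstAfter T)
          (measurableSet_firstAfter T)]
    _ ≤ c * 1 := by gcongr; exact prob_le_one
    _ = c := mul_one c

/-- Lack of memory: the waiting time after time `T` exceeds `R` with probability `exp (-R)`. -/
theorem measure_first_wait_gt_le {T R : ℝ} (hT : 0 ≤ T) (hR : 0 ≤ R) :
    waitingLaw (⋃ j, firstAfter T j ∩ {w | T + R < arrival w j})
      ≤ ENNReal.ofReal (Real.exp (-R)) := by
  refine measure_iUnion_firstAfter_inter_le T _ _ fun j => ?_
  have hev : Measurable fun v : ℕ → ℝ => v j := measurable_pi_apply j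
  have hind := (indepFun_truncate (I := Finset.range j) (J := {j}) (by simp)).comp
    measurable_id hev
  rw [Function.id_comp, indepFun_iff_map_prod_eq_prod_map_map (measurable_truncate _).aemeasurable
    (hev.comp (measurable_truncate _)).aemeasurable] at hind
  have hV : (fun v : ℕ → ℝ => v j) ∘ truncate {j} = fun w => w j := by
    funext w; simp [truncate]
  rw [hV, Measure.infinitePi_map_eval] at hind
  set γ := waitingLaw.map (truncate (Finset.range j))
  -- The past before ring `j`. Its last condition follows from the others if `j > 0` and from `0 ≤
  -- T` if `j = 0`; it keeps the remaining threshold nonnegative, as the exponential tail formula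
  -- requires.
  let G : Set (ℕ → ℝ) := {y | (∀ i < j, arrival y i ≤ T) ∧ ∑ i ∈ Finset.range j, y i ≤ T}
  have hG : MeasurableSet G := by
    have : G = (⋂ i ∈ Set.Iio j, {w | arrival w i ≤ T}) ∩
        {y | ∑ i ∈ Finset.range j, y i ≤ T} := by
      ext w; simp [G]
    rw [this]
    refine (MeasurableSet.biInter (Set.to_countable _) fun i _ => ?_).inter ?_
    · exact measurableSet_le (measurable_arrival i) measurable_const
    · exact measurableSet_le (by fun_prop) measurable_const
  let M : ℝ → Set ((ℕ → ℝ) × ℝ) := fun s =>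
    {p | p.1 ∈ G ∧ T + s < ∑ i ∈ Finset.range j, p.1 i + p.2}
  have hlin : Measurable fun p : (ℕ → ℝ) × ℝ => ∑ i ∈ Finset.range j, p.1 i + p.2 := by fun_prop
  have hM : ∀ s, MeasurableSet (M s) := fun s =>
    (measurable_fst hG).inter (measurableSet_lt measurable_const hlin)
  have hpair : Measurable fun w : ℕ → ℝ => (truncate (Finset.range j) w, w j) :=
    (measurable_truncate _).prodMk (measurable_pi_apply j)
  have hmeas : ∀ s, 0 ≤ s → waitingLaw (firstAfter T j ∩ {w | T + s < arrival w j})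
      = ∫⁻ y in G, ENNReal.ofReal (Real.exp (-(T + s - ∑ i ∈ Finset.range j, y i))) ∂γ := by
    intro s hs
    have h1 : firstAfter T j ∩ {w | T + s < arrival w j}
        = (fun w : ℕ → ℝ => (truncate (Finset.range j) w, w j)) ⁻¹' M s := by
      ext w
      have hsum : ∑ i ∈ Finset.range j, truncate (Finset.range j) w i
          = ∑ i ∈ Finset.range j, w i :=
        Finset.sum_congr rfl fun i hi => by rw [truncate, if_pos hi]
      have harr : arrival w j = ∑ i ∈ Finset.range j, w i + w j := Finset.sum_range_succ _ _
      simp only [firstAfter, Set.mem_inter_iff, Set.mem_ofPred_eq, M, G, Set.mem_preimage, hsum, harr]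
      constructor
      · rintro ⟨⟨h1, -⟩, h2⟩
        refine ⟨⟨fun i hi => by rw [arrival_truncate hi]; exact h1 i hi, ?_⟩, h2⟩
        rcases j with _ | j
        · simpa using hT
        · exact h1 j (Nat.lt_succ_self j)
      · rintro ⟨⟨h1, -⟩, h2⟩
        refine ⟨⟨fun i hi => by have := h1 i hi; rwa [arrival_truncate hi] at this, ?_⟩, h2⟩
        linarith
    rw [h1, ← Measure.map_apply hpair (hM s)]
    have : (fun w : ℕ → ℝ => (truncate (Finset.range j) w, w j)) =
      fun w => (truncate (Finset.range j) w, (fun w => w j) w) := rfl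
    rw [this, hind, Measure.prod_apply (hM s), ← lintegral_indicator hG]
    refine lintegral_congr fun y => ?_
    by_cases hy : y ∈ G
    · rw [Set.indicator_of_mem hy]
      have : Prod.mk y ⁻¹' M s = Set.Ioi (T + s - ∑ i ∈ Finset.range j, y i) := by
        ext v; simp [M, hy, sub_lt_iff_lt_add']
      rw [this, expMeasure_Ioi]
      linarith [hy.2]
    · rw [Set.indicator_of_notMem hy]
      have : Prod.mk y ⁻¹' M s = ∅ := by ext v; simp [M, hy]
      rw [this, measure_empty]
  have h0 := hmeas 0 le_rfl
  have hF : firstAfter T j ∩ {w | T + 0 < arrival w j} = firstAfter T j := by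
    ext w; simp [firstAfter]
  rw [hF] at h0
  rw [hmeas R hR, h0, ← lintegral_const_mul' _ _ ENNReal.ofReal_ne_top]
  refine lintegral_mono fun y => le_of_eq ?_
  rw [← ENNReal.ofReal_mul (Real.exp_pos _).le, ← Real.exp_add]
  congr 2; ring

/-- The `K` waiting times following the first ring after time `T` are all at most `L`
with probability at most `(1 - exp (-L)) ^ K`. -/
theorem measure_short_waits_le {T L : ℝ} (hL : 0 ≤ L) (K : ℕ) :
    waitingLaw (⋃ j, firstAfter T j ∩ {w | ∀ i ∈ Finset.Ico (j + 1) (j + 1 + K), w i ≤ L})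
      ≤ ENNReal.ofReal (1 - Real.exp (-L)) ^ K := by
  refine measure_iUnion_firstAfter_inter_le T _ _ fun j => ?_
  have hdisj : Disjoint (Finset.range (j + 1)) (Finset.Ico (j + 1) (j + 1 + K)) := by
    rw [Finset.disjoint_left]
    intro i hi hi'
    rw [Finset.mem_range] at hi
    rw [Finset.mem_Ico] at hi'
    omega
  set J := Finset.Ico (j + 1) (j + 1 + K)
  let E : Set (ℕ → ℝ) := (J : Set ℕ).pi fun _ => Set.Iic L
  have hE : MeasurableSet E := MeasurableSet.pi (Set.to_countable _) fun _ _ => measurableSet_Iic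
  have hEJ : truncate J ⁻¹' E = {w | ∀ i ∈ J, w i ≤ L} := by
    ext w
    simp only [E, Set.mem_preimage, Set.mem_pi, Finset.mem_coe, Set.mem_Iic, Set.mem_ofPred_eq]
    exact forall₂_congr fun i hi => by rw [truncate, if_pos hi]
  have hFJ : truncate (Finset.range (j + 1)) ⁻¹' firstAfter T j = firstAfter T j := by
    ext w
    simp only [firstAfter, Set.mem_preimage, Set.mem_ofPred_eq]
    rw [arrival_truncate (Nat.lt_succ_self j)]
    refine and_congr_left fun _ => forall₂_congr fun i hi => ?_
    rw [arrival_truncate (by omega)]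
  have := (indepFun_truncate hdisj).measure_inter_preimage_eq_mul _ _
    (measurableSet_firstAfter T j) hE
  rw [hEJ, hFJ] at this
  rw [this, mul_comm]
  gcongr
  have hE' : {w : ℕ → ℝ | ∀ i ∈ J, w i ≤ L} = E := by
    ext w; simp [E, Set.mem_pi]
  rw [hE', Measure.infinitePi_pi _ fun _ _ => measurableSet_Iic]
  simp [expMeasure_Iic hL, J]

theorem tendsto_one_sub_exp_pow (L : ℝ) :
    Tendsto (fun K : ℕ => ENNReal.ofReal (1 - Real.exp (-L)) ^ K) atTop (𝓝 0) := by
  refine ENNReal.tendsto_pow_atTop_nhds_zero_of_lt_one ?_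
  rw [ENNReal.ofReal_lt_one]
  linarith [Real.exp_pos (-L)]

/-- Waiting times which are positive and have an infinite sum. -/
def RegularWaits (w : ℕ → ℝ) : Prop := (∀ k, 0 < w k) ∧ Tendsto (arrival w) atTop atTop

theorem arrival_strictMono {w : ℕ → ℝ} (h : ∀ k, 0 < w k) : StrictMono (arrival w) :=
  strictMono_nat_of_lt_succ fun k => by
    unfold arrival
    rw [Finset.sum_range_succ _ (k + 1)]
    linarith [h (k + 1)]

theorem le_arrival {w : ℕ → ℝ} (h : ∀ k, 0 < w k) (k : ℕ) : w k ≤ arrival w k := by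
  unfold arrival
  rw [Finset.sum_range_succ]
  have : 0 ≤ ∑ i ∈ Finset.range k, w i := Finset.sum_nonneg fun i _ => (h i).le
  linarith

/-- For divergence, it suffices that some wait exceeds each given `n`; the first `K` waits all stay
below `n` with probability tending to zero in `K`. -/
theorem ae_regularWaits : ∀ᵐ w ∂waitingLaw, RegularWaits w := by
  have hpos : ∀ᵐ w ∂waitingLaw, ∀ k, 0 < w k := by
    rw [ae_all_iff]
    intro k
    have h1 : ∀ᵐ t ∂(expMeasure 1), 0 < t := by
      rw [ae_iff]
      have : {t : ℝ | ¬ 0 < t} = Set.Iic 0 := by ext; simp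
      rw [this, expMeasure_Iic le_rfl]
      simp
    exact (measurePreserving_eval_infinitePi (fun _ : ℕ => expMeasure 1) k).quasiMeasurePreserving.ae h1
  have hunb : ∀ᵐ w ∂waitingLaw, ∀ n : ℕ, ∃ i, (n : ℝ) < w i := by
    rw [ae_all_iff]
    intro n
    rw [ae_iff]
    refine le_antisymm ?_ (zero_le)
    refine ge_of_tendsto (tendsto_one_sub_exp_pow n) (Eventually.of_forall
      fun K => ?_)
    have hsub : {w : ℕ → ℝ | ¬ ∃ i, (n : ℝ) < w i} ⊆
        (Finset.range K : Set ℕ).pi fun _ => Set.Iic (n : ℝ) := by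
      intro w hw
      simp only [Set.mem_ofPred_eq, not_exists, not_lt] at hw
      exact fun i _ => hw i
    refine (measure_mono hsub).trans (le_of_eq ?_)
    rw [Measure.infinitePi_pi _ fun _ _ => measurableSet_Iic]
    simp [expMeasure_Iic]
  filter_upwards [hpos, hunb] with w h1 h2
  refine ⟨h1, tendsto_atTop_atTop.2 fun b => ?_⟩
  obtain ⟨n, hn⟩ := exists_nat_ge b
  obtain ⟨i, hi⟩ := h2 n
  refine ⟨i, fun k hk => ?_⟩
  have := (arrival_strictMono h1).monotone hk
  linarith [le_arrival h1 i]

theorem RegularWaits.exists_firstAfter {w : ℕ → ℝ} (h : RegularWaits w) (T : ℝ) :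
    ∃ j, w ∈ firstAfter T j := by
  classical
  have hex : ∃ j, T < arrival w j := (h.2.eventually (eventually_gt_atTop T)).exists
  exact ⟨Nat.find hex, fun i hi => not_lt.1 (Nat.find_min hex hi), Nat.find_spec hex⟩

/-- No ring between `T` and `T + R`. -/
def NoRing (T R : ℝ) (w : ℕ → ℝ) : Prop := ∀ k, ¬ (T < arrival w k ∧ arrival w k ≤ T + R)

/-- The rings between `T` and `T + L` are not contained in `K + 1` consecutive ones. -/
def ManyRings (T L : ℝ) (K : ℕ) (w : ℕ → ℝ) : Prop :=
  ¬ ∃ j, ∀ k, T < arrival w k → arrival w k ≤ T + L → k ∈ Finset.Ico j (j + 1 + K)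

theorem measure_noRing_le {T R : ℝ} (hT : 0 ≤ T) (hR : 0 ≤ R) :
    waitingLaw {w | NoRing T R w} ≤ ENNReal.ofReal (Real.exp (-R)) := by
  refine le_trans (measure_mono_ae ?_) (measure_first_wait_gt_le hT hR)
  filter_upwards [ae_regularWaits] with w hw hno
  obtain ⟨j, hj⟩ := hw.exists_firstAfter T
  refine Set.mem_iUnion.2 ⟨j, hj, ?_⟩
  by_contra hc
  exact hno j ⟨hj.2, not_lt.1 hc⟩

/-- Let `j` be the first ring after `T`. If one of the next `K` waits exceeds `L`, the ring ending
it lies beyond `T + L`, so only rings `j` to `j + K` can fall in the window. -/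
theorem measure_manyRings_le {T L : ℝ} (hL : 0 ≤ L) (K : ℕ) :
    waitingLaw {w | ManyRings T L K w} ≤ ENNReal.ofReal (1 - Real.exp (-L)) ^ K := by
  refine le_trans (measure_mono_ae ?_) (measure_short_waits_le (T := T) hL K)
  filter_upwards [ae_regularWaits] with w hw hmany
  obtain ⟨j, hj⟩ := hw.exists_firstAfter T
  refine Set.mem_iUnion.2 ⟨j, hj, ?_⟩
  by_contra hc
  simp only [Set.mem_ofPred_eq, not_forall, not_le] at hc
  obtain ⟨i, hi, hLi⟩ := hc
  rw [Finset.mem_Ico] at hi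
  have hmono := arrival_strictMono hw.1
  refine hmany ⟨j, fun k hk1 hk2 => ?_⟩
  rw [Finset.mem_Ico]
  constructor
  · by_contra! hkj
    exact absurd (hj.1 k hkj) (not_le.2 hk1)
  · by_contra! hkj
    have h1 : arrival w i ≤ arrival w k := hmono.monotone (by omega)
    obtain ⟨i, rfl⟩ : ∃ i', i = i' + 1 := ⟨i - 1, by omega⟩
    have h2 : arrival w (i + 1) = arrival w i + w (i + 1) := Finset.sum_range_succ _ _
    have h3 : arrival w j ≤ arrival w i := hmono.monotone (by omega)
    linarith [hj.2]

end Clocks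

/-! ### Favorable time windows -/

section Windows

variable {d : ℕ}

theorem ae_clock_of_ae_waiting {p : (ℕ → ℝ) → Prop} (x : Site d) (h : ∀ᵐ w ∂waitingLaw, p w) :
    ∀ᵐ τ ∂(clockLaw d), p (τ x) :=
  (measurePreserving_eval_infinitePi (fun _ : Site d => waitingLaw) x).quasiMeasurePreserving.ae h

/-- An inequality is enough, and it holds without measurability of `p`. -/
theorem measure_clock_le (x : Site d) (p : (ℕ → ℝ) → Prop) :
    clockLaw d {τ | p (τ x)} ≤ waitingLaw {w | p w} := by
  rw [← (measurePreserving_eval_infinitePi (fun _ : Site d => waitingLaw) x).map_eq]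
  exact Measure.le_map_apply (measurable_pi_apply x).aemeasurable _

instance : IsProbabilityMeasure (clockLaw d) := by unfold clockLaw; infer_instance

instance : IsProbabilityMeasure (coinLaw d) := by unfold coinLaw; infer_instance

/-- In the window of length `N * R` starting at time `m * (N * R)`, all clocks in `A` ring
in each of the `N` consecutive parts of length `R`, and each of them rings at most
`K + 1` times. -/
def GoodWindow (A : Finset (Site d)) (N R K m : ℕ) (τ : Clocks d) : Prop :=
  ∀ x ∈ A, (∀ i < N, ¬ NoRing (m * (N * R) + i * R) R (τ x)) ∧
    ¬ ManyRings (m * (N * R)) (N * R) K (τ x)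

theorem measure_not_goodWindow_le (A : Finset (Site d)) (N R K m : ℕ) :
    clockLaw d {τ | ¬ GoodWindow A N R K m τ} ≤ A.card *
      (N * ENNReal.ofReal (Real.exp (-R)) + ENNReal.ofReal (1 - Real.exp (-(N * R))) ^ K) := by
  have hsub : {τ : Clocks d | ¬ GoodWindow A N R K m τ} ⊆
      ⋃ x ∈ A, ((⋃ i ∈ Finset.range N, {τ | NoRing (m * (N * R) + i * R) R (τ x)}) ∪
        {τ | ManyRings (m * (N * R)) (N * R) K (τ x)}) := by
    intro τ hτ
    simp only [GoodWindow, Set.mem_ofPred_eq, not_forall, not_and_or, not_not] at hτ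
    obtain ⟨x, hx, h⟩ := hτ
    simp only [Set.mem_iUnion]
    refine ⟨x, hx, h.imp ?_ id⟩
    rintro ⟨i, hi, h⟩
    simp only [Set.mem_iUnion, Finset.mem_range]
    exact ⟨i, hi, h⟩
  refine (measure_mono hsub).trans ((measure_biUnion_finset_le _ _).trans ?_)
  refine (Finset.sum_le_card_nsmul A _ _ fun x _ => ?_).trans (nsmul_eq_mul _ _).le
  refine (measure_union_le _ _).trans (add_le_add ?_ ?_)
  · refine (measure_biUnion_finset_le _ _).trans ?_
    calc _ ≤ ∑ _i ∈ Finset.range N, ENNReal.ofReal (Real.exp (-R)) :=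
          Finset.sum_le_sum fun i _ => (measure_clock_le x (NoRing _ _)).trans
            (measure_noRing_le (by positivity) (by positivity))
      _ = _ := by simp
  · exact (measure_clock_le x (ManyRings _ _ _)).trans (measure_manyRings_le (by positivity) K)

/-- `R` is chosen first, to make missing rings unlikely, and then `K`, because the window length `N
* R` enters the bound on the number of rings. Both choices are uniform in `m`. -/
theorem exists_measure_not_goodWindow_le (A : Finset (Site d)) (N : ℕ) {ε : ℝ≥0∞} (hε : 0 < ε) :
    ∃ R K : ℕ, 1 ≤ R ∧ ∀ m, clockLaw d {τ | ¬ GoodWindow A N R K m τ} ≤ ε := by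
  have h1 : Tendsto (fun R : ℕ => (A.card : ℝ≥0∞) * (N * ENNReal.ofReal (Real.exp (-R)))) atTop
      (𝓝 (A.card * (N * ENNReal.ofReal 0))) := by
    refine ENNReal.Tendsto.const_mul (ENNReal.Tendsto.const_mul ?_ (Or.inr (by simp)))
      (Or.inr (by simp))
    refine ENNReal.tendsto_ofReal ?_
    exact Real.tendsto_exp_neg_atTop_nhds_zero.comp tendsto_natCast_atTop_atTop
  simp only [ENNReal.ofReal_zero, mul_zero] at h1
  have hε2 : 0 < ε / 2 := ENNReal.half_pos hε.ne'
  obtain ⟨R, hR1, hR⟩ := ((eventually_ge_atTop 1).and (h1.eventually (gt_mem_nhds hε2))).exists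
  have h2 : Tendsto (fun K : ℕ => (A.card : ℝ≥0∞) *
      ENNReal.ofReal (1 - Real.exp (-(N * R))) ^ K) atTop (𝓝 (A.card * 0)) :=
    ENNReal.Tendsto.const_mul (tendsto_one_sub_exp_pow _) (Or.inr (by simp))
  rw [mul_zero] at h2
  obtain ⟨K, hK⟩ := (h2.eventually (gt_mem_nhds hε2)).exists
  refine ⟨R, K, hR1, fun m => (measure_not_goodWindow_le A N R K m).trans ?_⟩
  rw [mul_add, ← ENNReal.add_halves ε]
  exact add_le_add hR.le hK.le

/-- Independence of the windows is not used. That all windows from `M` on fail has probability at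
most that of a single failure, and these events increase with `M`, so eventual failure has
probability at most `ε`. As `R` and `K` depend on `ε`, they are quantified inside the almost sure
statement. -/
theorem ae_frequently_goodWindow (A : Finset (Site d)) (N : ℕ) :
    ∀ᵐ τ ∂(clockLaw d), ∃ R K : ℕ, 1 ≤ R ∧ ∃ᶠ m in atTop, GoodWindow A N R K m τ := by
  rw [ae_iff]
  refine le_antisymm (le_of_forall_gt_imp_ge_of_dense fun ε hε => ?_) zero_le
  obtain ⟨R, K, hR, hm⟩ := exists_measure_not_goodWindow_le A N hε
  have hsub : {τ : Clocks d | ¬ ∃ R K : ℕ, 1 ≤ R ∧ ∃ᶠ m in atTop, GoodWindow A N R K m τ} ⊆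
      ⋃ M : ℕ, {τ | ∀ m, M ≤ m → ¬ GoodWindow A N R K m τ} := by
    intro τ hτ
    have h : ¬ ∃ᶠ m in atTop, GoodWindow A N R K m τ := fun h => hτ ⟨R, K, hR, h⟩
    rw [not_frequently, eventually_atTop] at h
    exact Set.mem_iUnion.2 h
  refine (measure_mono hsub).trans ?_
  rw [Monotone.measure_iUnion]
  · refine iSup_le fun M => le_trans (measure_mono ?_) (hm M)
    exact fun τ hτ => hτ M le_rfl
  · exact fun M M' hMM τ hτ m hm => hτ m (hMM.trans hm)

/-- Among infinitely many disjoint sets of coins of bounded sizes, one shows only heads. -/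
theorem ae_exists_all_heads (J : ℕ → Finset (Site d × ℕ)) {M : ℕ} (hM : ∀ n, (J n).card ≤ M)
    (hJ : ∀ n m, n ≠ m → Disjoint (J n) (J m)) :
    ∀ᵐ c ∂(coinLaw d), ∃ n, ∀ p ∈ J n, c p.1 p.2 = true := by
  set ν : Measure Bool := (PMF.uniformOfFintype Bool).toMeasure
  have hν : ν.real {true} = 1 / 2 := by
    simp [ν, measureReal_def]
  set π : Measure (Site d × ℕ → Bool) := Measure.infinitePi fun _ => ν
  have hπ : IsProbabilityMeasure π := inferInstanceAs (IsProbabilityMeasure (Measure.infinitePi _))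
  -- Uncurrying turns the coins into one product over pairs of a site and a ring, to which
  -- independence of local events applies.
  have hmap : (coinLaw d).map (MeasurableEquiv.curry (Site d) ℕ Bool).symm = π :=
    Measure.infinitePi_map_curry_symm fun _ _ => ν
  have hae : ∀ᵐ b ∂π, ∃ n, ∀ p ∈ J n, b p = true := by
    rw [ae_iff]
    set r : ℝ := 1 - (1 / 2) ^ M
    have hr1 : r < 1 := by simp only [r]; linarith [pow_pos (one_half_pos (α := ℝ)) M]
    have hr0 : 0 ≤ r := by
      simp only [r]
      linarith [pow_le_one₀ (n := M) (one_half_pos (α := ℝ)).le one_half_lt_one.le]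
    have hbound : ∀ m : ℕ, π.real {b : Site d × ℕ → Bool | ¬ ∃ n, ∀ p ∈ J n, b p = true} ≤ r ^ m := by
      intro m
      have hsub : {b : Site d × ℕ → Bool | ¬ ∃ n, ∀ p ∈ J n, b p = true} ⊆
          ⋂ n ∈ Finset.range m, {b : Site d × ℕ → Bool | ∀ p ∈ J n, b p = true}ᶜ := by
        intro b hb
        simp only [Set.mem_iInter]
        exact fun n _ hn => hb ⟨n, hn⟩
      refine (measureReal_mono hsub (measure_ne_top _ _)).trans ?_
      rw [LocalOn.measureReal_biInter ν (S := J) _ (fun n _ => (localOn_forall_mem_eq _ _).compl)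
        fun n _ m _ hnm => hJ n m hnm]
      calc _ ≤ ∏ _n ∈ Finset.range m, r := by
            refine Finset.prod_le_prod (fun _ _ => measureReal_nonneg) fun n _ => ?_
            rw [probReal_compl_eq_one_sub (localOn_forall_mem_eq _ _).measurableSet,
              measureReal_forall_mem_eq, hν]
            have := pow_le_pow_of_le_one (one_half_pos (α := ℝ)).le one_half_lt_one.le (hM n)
            linarith
        _ = r ^ m := by simp
    have h0 : π.real {b : Site d × ℕ → Bool | ¬ ∃ n, ∀ p ∈ J n, b p = true} ≤ 0 :=
      ge_of_tendsto (tendsto_pow_atTop_nhds_zero_of_lt_one hr0 hr1)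
        (Eventually.of_forall hbound)
    exact (measureReal_eq_zero_iff (measure_ne_top _ _)).1 (le_antisymm h0 measureReal_nonneg)
  rw [← hmap] at hae
  exact ae_of_ae_map (MeasurableEquiv.measurable _).aemeasurable hae

/-- From time `T` on, for the duration `N * R`, all clocks in `A` ring in each of the `N`
consecutive intervals of length `R`, and all coins of these rings show heads. -/
def HeadsWindow (A : Finset (Site d)) (N : ℕ) (T R : ℝ) (ω : Clocks d × Coins d) : Prop :=
  ∀ x ∈ A, (∀ i < N, ∃ k, T + i * R < ringTime ω.1 x k ∧ ringTime ω.1 x k ≤ T + i * R + R) ∧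
    ∀ k, T < ringTime ω.1 x k → ringTime ω.1 x k ≤ T + N * R → ω.2 x k = true

theorem measurableSet_headsWindow (A : Finset (Site d)) (N : ℕ) (T R : ℝ) :
    MeasurableSet {ω : Clocks d × Coins d | HeadsWindow A N T R ω} := by
  have hring : ∀ (x : Site d) k, Measurable fun ω : Clocks d × Coins d => ringTime ω.1 x k := by
    intro x k
    unfold ringTime
    fun_prop
  have hcoin : ∀ (x : Site d) k, Measurable fun ω : Clocks d × Coins d => ω.2 x k := by
    intro x k
    fun_prop
  have : {ω : Clocks d × Coins d | HeadsWindow A N T R ω} = ⋂ x ∈ A,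
      ((⋂ i ∈ Finset.range N, ⋃ k, {ω | T + i * R < ringTime ω.1 x k} ∩
        {ω | ringTime ω.1 x k ≤ T + i * R + R}) ∩
      ⋂ k, ({ω | T < ringTime ω.1 x k}ᶜ ∪ ({ω | ringTime ω.1 x k ≤ T + N * R}ᶜ ∪
        {ω | ω.2 x k = true}))) := by
    ext ω
    simp only [HeadsWindow, Set.mem_ofPred_eq, Set.mem_iInter, Set.mem_inter_iff, Set.mem_iUnion,
      Finset.mem_range, Set.mem_union, Set.mem_compl_iff, imp_iff_not_or]
  rw [this]
  refine Finset.measurableSet_biInter _ fun x _ => MeasurableSet.inter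
    (Finset.measurableSet_biInter _ fun i _ => MeasurableSet.iUnion fun k => ?_)
    (MeasurableSet.iInter fun k => ?_)
  · exact (measurableSet_lt measurable_const (hring x k)).inter
      (measurableSet_le (hring x k) measurable_const)
  · exact (measurableSet_lt measurable_const (hring x k)).compl.union
      ((measurableSet_le (hring x k) measurable_const).compl.union
        (hcoin x k (measurableSet_singleton true)))

/-- With the clocks fixed, infinitely many windows are good. Their rings use disjoint sets of at
most `#A * (K + 1)` coins each, so almost surely one window sees only heads. -/
theorem ae_exists_headsWindow (A : Finset (Site d)) (N : ℕ) :
    ∀ᵐ ω ∂((clockLaw d).prod (coinLaw d)), ∃ R m : ℕ, HeadsWindow A N (m * (N * R)) R ω := by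
  have hmeas : MeasurableSet {ω : Clocks d × Coins d |
      ∃ R m : ℕ, HeadsWindow A N (m * (N * R)) R ω} := by
    have : {ω : Clocks d × Coins d | ∃ R m : ℕ, HeadsWindow A N (m * (N * R)) R ω}
        = ⋃ (R : ℕ) (m : ℕ), {ω | HeadsWindow A N (m * (N * R)) R ω} := by
      ext; simp
    rw [this]
    exact MeasurableSet.iUnion fun R => MeasurableSet.iUnion fun m =>
      measurableSet_headsWindow A N _ _
  rw [Measure.ae_prod_iff_ae_ae hmeas]
  filter_upwards [ae_frequently_goodWindow A N] with τ hτ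
  obtain ⟨R, K, hR, hfreq⟩ := hτ
  obtain ⟨φ, hφ, hgood⟩ := extraction_of_frequently_atTop hfreq
  have hex : ∀ n, ∀ x ∈ A, ∃ j, ∀ k, (φ n : ℝ) * (N * R) < arrival (τ x) k →
      arrival (τ x) k ≤ φ n * (N * R) + N * R → k ∈ Finset.Ico j (j + 1 + K) :=
    fun n x hx => not_not.1 (hgood n x hx).2
  choose! j hj using hex
  classical
  let J : ℕ → Finset (Site d × ℕ) := fun n =>
    (A.sigma fun x => (Finset.Ico (j n x) (j n x + 1 + K)).filter fun k =>
      (φ n : ℝ) * (N * R) < arrival (τ x) k ∧ arrival (τ x) k ≤ φ n * (N * R) + N * R).image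
      fun p => (p.1, p.2)
  have hJmem : ∀ n x k, (x, k) ∈ J n ↔ x ∈ A ∧ (φ n : ℝ) * (N * R) < arrival (τ x) k ∧
      arrival (τ x) k ≤ φ n * (N * R) + N * R := by
    intro n x k
    simp only [J, Finset.mem_image, Finset.mem_sigma, Finset.mem_filter]
    constructor
    · rintro ⟨⟨x', k'⟩, ⟨h1, h2, h3⟩, he⟩
      simp only [Prod.mk.injEq] at he
      obtain ⟨rfl, rfl⟩ := he
      exact ⟨h1, h3⟩
    · rintro ⟨h1, h2⟩
      exact ⟨⟨x, k⟩, ⟨h1, hj n x h1 k h2.1 h2.2, h2⟩, rfl⟩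
  have hcard : ∀ n, (J n).card ≤ A.card * (1 + K) := by
    intro n
    refine Finset.card_image_le.trans ?_
    rw [Finset.card_sigma]
    refine Finset.sum_le_card_nsmul _ _ _ fun x _ => (Finset.card_filter_le _ _).trans ?_
    rw [Nat.card_Ico]
    omega
  -- The windows are open on the left and closed on the right, so consecutive ones share no ring.
  have hdisj : ∀ n m, n < m → Disjoint (J n) (J m) := by
    intro n m hnm
    rw [Finset.disjoint_left]
    rintro ⟨x, k⟩ hn hm
    rw [hJmem] at hn hm
    have h1 : (φ n : ℝ) + 1 ≤ φ m := by exact_mod_cast hφ hnm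
    have h2 : ((φ n : ℝ) + 1) * (N * R) ≤ φ m * (N * R) := by gcongr
    linarith [hn.2.2, hm.2.1]
  have hdisj' : ∀ n m, n ≠ m → Disjoint (J n) (J m) := fun n m h =>
    (lt_or_gt_of_ne h).elim (hdisj n m) fun h => (hdisj m n h).symm
  filter_upwards [ae_exists_all_heads J hcard hdisj'] with c hc
  obtain ⟨n, hn⟩ := hc
  refine ⟨R, φ n, fun x hx => ⟨fun i hi => ?_, fun k hk1 hk2 => ?_⟩⟩
  · have := (hgood n x hx).1 i hi
    simp only [NoRing, not_forall, not_not] at this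
    exact this
  · exact hn (x, k) ((hJmem n x k).2 ⟨hx, hk1, hk2⟩)

end Windows

/-! ### Spanned sets with frozen corners become plus -/

section Dynamics

variable {d : ℕ}

/-- Strict plus majority thus means more than `d` plus neighbors and a tie exactly `d`; with heads,
the update to plus is bootstrap percolation with threshold `d`. -/
theorem neighborSum_eq (s : Config d) (x : Site d) :
    neighborSum s x = 2 * nbrsIn Finset.univ {y | s y = 1} x - 2 * d := by
  have h : ∀ y, ((s y : ℤˣ) : ℤ) = 2 * (if s y = 1 then 1 else 0) - 1 := by
    intro y
    rcases Int.units_eq_one_or (s y) with h | h <;> simp [h]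
  simp only [neighborSum, nbrsIn, h, Set.mem_ofPred_eq]
  push_cast
  rw [Finset.mul_sum]
  have : (2 : ℤ) * d = ∑ _i : Fin d, (2 : ℤ) := by simp [mul_comm]
  rw [this, ← Finset.sum_sub_distrib]
  exact Finset.sum_congr rfl fun i _ => by ring

theorem updatedSpin_eq_one_of_lt {s : Config d} {x : Site d} {B : Set (Site d)}
    (hB : ∀ y ∈ B, s y = 1) (h : d < nbrsIn Finset.univ B x) (b : Bool) :
    updatedSpin s x b = 1 := by
  have h1 := nbrsIn_mono Finset.univ (D := B) (D' := {y | s y = 1}) hB x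
  rw [updatedSpin, if_pos]
  rw [neighborSum_eq]
  omega

theorem updatedSpin_true_eq_one {s : Config d} {x : Site d} {B : Set (Site d)}
    (hB : ∀ y ∈ B, s y = 1) (h : d ≤ nbrsIn Finset.univ B x) :
    updatedSpin s x true = 1 := by
  have h1 := nbrsIn_mono Finset.univ (D := B) (D' := {y | s y = 1}) hB x
  have h2 := neighborSum_eq s x
  rw [updatedSpin]
  by_cases h3 : 0 < neighborSum s x
  · rw [if_pos h3]
  · rw [if_neg h3, if_neg (by omega), if_pos rfl]

/-- The vertices of `C` reached from `A` in `j` steps of bootstrap percolation with threshold `d`. -/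
def fill (A : Set (Site d)) (C : Finset (Site d)) : ℕ → Set (Site d)
  | 0 => {x | x ∈ C ∧ x ∈ A}
  | j + 1 => fill A C j ∪ {x | x ∈ C ∧ d ≤ nbrsIn Finset.univ (fill A C j) x}

theorem fill_mono (A : Set (Site d)) (C : Finset (Site d)) : Monotone (fill A C) :=
  monotone_nat_of_le_succ fun _ => Set.subset_union_left

/-- The union of all stages is closed under the bootstrap rule, since the finitely many neighbors of
a vertex have all joined by a common stage. Finiteness of `C` then bounds the number of stages. -/
theorem Spanned.exists_fill {A : Set (Site d)} {C : Finset (Site d)}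
    (h : Spanned A Finset.univ C) : ∃ N, ∀ x ∈ C, x ∈ fill A C N := by
  classical
  have hev : ∀ y, ∀ᶠ j in atTop, y ∈ ⋃ j, fill A C j → y ∈ fill A C j := by
    intro y
    by_cases hy : y ∈ ⋃ j, fill A C j
    · obtain ⟨j₀, hj₀⟩ := Set.mem_iUnion.1 hy
      filter_upwards [eventually_ge_atTop j₀] with j hj _ using fill_mono A C hj hj₀
    · exact Eventually.of_forall fun j h => absurd h hy
  have hall := h (⋃ j, fill A C j) (fun x hx hA => Set.mem_iUnion.2 ⟨0, hx, hA⟩) fun x hx hn => by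
    have h1 : ∀ᶠ j in atTop, ∀ i : Fin d,
        (x + Pi.single i 1 ∈ ⋃ j, fill A C j → x + Pi.single i 1 ∈ fill A C j) ∧
        (x - Pi.single i 1 ∈ ⋃ j, fill A C j → x - Pi.single i 1 ∈ fill A C j) := by
      rw [eventually_all]
      exact fun i => (hev _).and (hev _)
    obtain ⟨j, hj⟩ := h1.exists
    refine Set.mem_iUnion.2 ⟨j + 1, Or.inr ⟨hx, ?_⟩⟩
    rw [Finset.card_univ, Fintype.card_fin] at hn
    refine hn.trans (Finset.sum_le_sum fun i _ => add_le_add ?_ ?_)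
    · by_cases hi : x + Pi.single i 1 ∈ ⋃ j, fill A C j
      · rw [if_pos hi, if_pos ((hj i).1 hi)]
      · rw [if_neg hi]; exact Nat.zero_le _
    · by_cases hi : x - Pi.single i 1 ∈ ⋃ j, fill A C j
      · rw [if_pos hi, if_pos ((hj i).2 hi)]
      · rw [if_neg hi]; exact Nat.zero_le _
  have : ∀ᶠ j in atTop, ∀ x ∈ C, x ∈ fill A C j := by
    rw [eventually_all_finset]
    intro x hx
    filter_upwards [hev x] with j hj using hj (hall x hx)
  exact this.exists

theorem RegularWaits.exists_last {w : ℕ → ℝ} (hw : RegularWaits w) {t : ℝ} {k₀ : ℕ}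
    (hk₀ : arrival w k₀ ≤ t) :
    ∃ k, k₀ ≤ k ∧ arrival w k ≤ t ∧ ∀ j, ¬ (arrival w k < arrival w j ∧ arrival w j ≤ t) := by
  obtain ⟨j, hj⟩ := hw.exists_firstAfter t
  have hmono := arrival_strictMono hw.1
  have hj0 : k₀ < j := by
    by_contra! hc
    exact absurd (hj.2.trans_le (hmono.monotone hc)) (not_lt.2 hk₀)
  obtain ⟨j, rfl⟩ : ∃ i, j = i + 1 := ⟨j - 1, by omega⟩
  refine ⟨j, by omega, hj.1 j (Nat.lt_succ_self j), fun i hi => ?_⟩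
  have h1 : j < i := hmono.lt_iff_lt.1 hi.1
  exact absurd (hj.2.trans_le (hmono.monotone h1)) (not_lt.2 hi.2)

theorem arrival_pos {w : ℕ → ℝ} (h : ∀ k, 0 < w k) (k : ℕ) : 0 < arrival w k :=
  (h k).trans_le (le_arrival h k)

variable {ω : Sample d} {s₀ : Config d} {σ : ℝ≥0 → Config d}

/-- The spin at time `t` is the one to which the last ring has updated it. -/
theorem IsTrajectory.exists_update (hσ : IsTrajectory ω s₀ σ) {x : Site d}
    (hw : RegularWaits (ω.2.1 x)) (hx : ω.1 x = .unfrozen) {t : ℝ≥0} {k₀ : ℕ} {s : ℝ}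
    (hs : s < ringTime ω.2.1 x k₀) (hk₀ : ringTime ω.2.1 x k₀ ≤ t) :
    ∃ (k : ℕ) (u : ℝ≥0), s < ringTime ω.2.1 x k ∧ ringTime ω.2.1 x k ≤ t ∧
      s < u ∧ (u : ℝ) < ringTime ω.2.1 x k ∧ σ t x = updatedSpin (σ u) x (ω.2.2 x k) := by
  obtain ⟨k, hkk, hkt, hlast⟩ := hw.exists_last hk₀
  have hpos := arrival_pos hw.1 k
  let r : ℝ≥0 := ⟨ringTime ω.2.1 x k, hpos.le⟩
  have hsr : s < r := hs.trans_le ((arrival_strictMono hw.1).monotone hkk)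
  have hconst : σ t x = σ r x := hσ.const x r t (by exact_mod_cast hkt) hlast
  have hup := hσ.update x hx k r rfl
  have hev : ∀ᶠ u : ℝ≥0 in 𝓝[<] r, s < u :=
    ((NNReal.continuous_coe.tendsto r).eventually (eventually_gt_nhds hsr)).filter_mono
      nhdsWithin_le_nhds
  have hne : (𝓝[<] r).NeBot := nhdsLT_neBot_of_exists_lt ⟨0, by exact_mod_cast hpos⟩
  obtain ⟨u, hu1, hu2, hu3⟩ := (hup.and (hev.and self_mem_nhdsWithin)).exists
  exact ⟨k, u, hsr, hkt, hu2, by exact_mod_cast hu3, hconst.trans hu1⟩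

theorem IsTrajectory.eq_one_of_frozenPlus (hσ : IsTrajectory ω s₀ σ) {x : Site d}
    (hx : ω.1 x = .frozenPlus) (t : ℝ≥0) : σ t x = 1 := by
  rw [hσ.frozen x (by rw [hx]; exact fun h => by cases h), hσ.init, hx]
  rfl

/-- A set, each unfrozen vertex of which has more than `d` neighbors in it, stays plus. -/
theorem IsTrajectory.stays_plus (hσ : IsTrajectory ω s₀ σ) (hw : ∀ x, RegularWaits (ω.2.1 x))
    {C : Finset (Site d)} (hC : ∀ x ∈ C, ω.1 x ≠ .frozenMinus)
    (hstab : ∀ x ∈ C, ω.1 x = .unfrozen → d < nbrsIn Finset.univ (C : Set (Site d)) x)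
    {T : ℝ≥0} (hT : ∀ x ∈ C, σ T x = 1) : ∀ t, T ≤ t → ∀ x ∈ C, σ t x = 1 := by
  choose f hf using fun (x : Site d) (t : ℝ) => (hw x).exists_firstAfter t
  have hlt : ∀ x t k, k < f x t ↔ arrival (ω.2.1 x) k ≤ t := by
    intro x t k
    constructor
    · exact fun h => (hf x t).1 k h
    · intro h
      by_contra! hc
      have := (arrival_strictMono (hw x).1).monotone hc
      linarith [(hf x t).2]
  have hmono : ∀ x s t, s ≤ t → f x s ≤ f x t := by
    intro x s t hst
    by_contra! hc
    have h1 := (hlt x s _).1 hc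
    exact absurd ((hlt x t _).2 (h1.trans hst)) (lt_irrefl _)
  suffices h : ∀ n, ∀ t : ℝ≥0, T ≤ t → ∑ x ∈ C, f x t = n → ∀ x ∈ C, σ t x = 1 from
    fun t ht => h _ t ht rfl
  -- Induction on the number of rings in the finite set `C` up to time `t`. The last update at `x`
  -- looks at a time `u` strictly before that ring, when fewer rings have occurred; rings elsewhere
  -- on the lattice do not matter.
  intro n
  induction n using Nat.strong_induction_on with
  | _ n ih =>
    intro t ht hn x hx
    cases hωx : ω.1 x with
    | frozenPlus => exact hσ.eq_one_of_frozenPlus hωx t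
    | frozenMinus => exact absurd hωx (hC x hx)
    | unfrozen =>
      by_cases hring : ∃ k, (T : ℝ) < ringTime ω.2.1 x k ∧ ringTime ω.2.1 x k ≤ t
      · obtain ⟨k₀, h1, h2⟩ := hring
        obtain ⟨k, u, hk1, hk2, hu1, hu2, he⟩ := hσ.exists_update (hw x) hωx h1 h2
        rw [he]
        refine updatedSpin_eq_one_of_lt (B := (C : Set (Site d))) ?_ (hstab x hx hωx) _
        refine ih (∑ y ∈ C, f y u) ?_ u (by exact_mod_cast hu1.le) rfl
        rw [← hn]
        refine Finset.sum_lt_sum (fun y _ => hmono y u t (hu2.le.trans hk2)) ⟨x, hx, ?_⟩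
        have h3 : k < f x t := (hlt x t k).2 hk2
        have h4 : ¬ k < f x u := fun h => absurd ((hlt x u k).1 h) (not_le.2 hu2)
        omega
      · rw [hσ.const x T t ht (not_exists.1 hring)]
        exact hT x hx

/-- During a window of heads the set of plus spins runs through the steps of
bootstrap percolation. -/
theorem IsTrajectory.fill_plus (hσ : IsTrajectory ω s₀ σ) (hw : ∀ x, RegularWaits (ω.2.1 x))
    {C : Finset (Site d)} (hC : ∀ x ∈ C, ω.1 x ≠ .frozenMinus) {N : ℕ} {T R : ℝ} (hR : 0 ≤ R)
    (hwin : HeadsWindow C N T R ω.2) :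
    ∀ j ≤ N, ∀ t : ℝ≥0, T + j * R ≤ t → t ≤ T + N * R →
      ∀ x ∈ fill {x | ω.1 x = .frozenPlus} C j, σ t x = 1 := by
  intro j
  induction j with
  | zero => exact fun _ t _ _ x hx => hσ.eq_one_of_frozenPlus hx.2 t
  | succ j ih =>
    intro hj t ht1 ht2 x hx
    have ih := ih (by omega)
    push_cast at ht1
    rcases hx with hx | ⟨hxC, hxd⟩
    · exact ih t (by linarith) ht2 x hx
    cases hωx : ω.1 x with
    | frozenPlus => exact hσ.eq_one_of_frozenPlus hωx t
    | frozenMinus => exact absurd hωx (hC x hxC)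
    | unfrozen =>
      obtain ⟨hrings, hheads⟩ := hwin x hxC
      obtain ⟨k₀, h1, h2⟩ := hrings j (by omega)
      -- The last ring up to `t` may come after the interval number `j`, but it is still in the
      -- window, so its coin is heads; and at time `u > T + j * R` stage `j` is already plus.
      obtain ⟨k, u, hk1, hk2, hu1, hu2, he⟩ :=
        hσ.exists_update (t := t) (hw x) hωx h1 (by linarith)
      have hjR : 0 ≤ (j : ℝ) * R := by positivity
      rw [he, hheads k (by linarith) (by linarith)]
      exact updatedSpin_true_eq_one (ih u hu1.le (by linarith)) hxd

/-- A vertex of a cube which is not a corner has more than `d` neighbors in the cube. -/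
theorem lt_nbrsIn_centeredCube {k : ℕ} {c x : Site d} (hx : x ∈ centeredCube k c)
    (hx' : x ∉ corners k c) : d < nbrsIn Finset.univ (centeredCube k c : Set (Site d)) x := by
  classical
  rw [mem_corners] at hx'
  push Not at hx'
  obtain ⟨i₀, hi₀⟩ := hx'
  rw [mem_centeredCube] at hx
  have hp : ∀ i, x i < c i + k → x + Pi.single i 1 ∈ (centeredCube k c : Set (Site d)) := by
    intro i hi
    rw [Finset.mem_coe, mem_centeredCube]
    intro j
    have := hx j
    by_cases hj : j = i
    · subst hj; simp; omega
    · simpa [hj] using this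
  have hm : ∀ i, c i - k < x i → x - Pi.single i 1 ∈ (centeredCube k c : Set (Site d)) := by
    intro i hi
    rw [Finset.mem_coe, mem_centeredCube]
    intro j
    have := hx j
    by_cases hj : j = i
    · subst hj; simp; omega
    · simpa [hj] using this
  have hk : 0 < k := by
    have := hx i₀
    omega
  have hd : d = ∑ _i : Fin d, 1 := by simp
  calc d = ∑ _i : Fin d, 1 := hd
    _ < _ := by
      -- Every direction contributes at least one neighbor in the cube, and `i₀`, in which `x` is
      -- not extremal, contributes two.
      refine Finset.sum_lt_sum (fun i _ => ?_) ⟨i₀, Finset.mem_univ _, ?_⟩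
      · have := hx i
        by_cases hi : x i < c i + k
        · rw [if_pos (hp i hi)]; omega
        · rw [if_pos (hm i (by omega))]; omega
      · have := hx i₀
        rw [if_pos (hp i₀ (by omega)), if_pos (hm i₀ (by omega))]
        omega

/-- In a spanned cube without frozen minus vertices and with frozen plus corners,
all spins are eventually plus. -/
theorem IsTrajectory.eventually_plus (hσ : IsTrajectory ω s₀ σ)
    (hw : ∀ x, RegularWaits (ω.2.1 x)) {k : ℕ} {c : Site d}
    (hC : ∀ x ∈ centeredCube k c, ω.1 x ≠ .frozenMinus)
    (hcorn : ∀ x ∈ corners k c, ω.1 x = .frozenPlus)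
    (hspan : Spanned {x | ω.1 x = .frozenPlus} Finset.univ (centeredCube k c))
    (hwin : ∀ N : ℕ, ∃ R m : ℕ, HeadsWindow (centeredCube k c) N (m * (N * R)) R ω.2) :
    ∃ T : ℝ≥0, ∀ t, T ≤ t → ∀ x ∈ centeredCube k c, σ t x = 1 := by
  obtain ⟨N, hN⟩ := hspan.exists_fill
  obtain ⟨R, m, hRm⟩ := hwin N
  refine ⟨m * (N * R) + N * R, hσ.stays_plus hw hC (fun x hx hu => ?_) fun x hx => ?_⟩
  · refine lt_nbrsIn_centeredCube hx fun hc => ?_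
    rw [hcorn x hc] at hu
    cases hu
  · exact hσ.fill_plus hw hC (Nat.cast_nonneg R) hRm N le_rfl _ (by push_cast; rfl)
      (by push_cast; rfl) x (hN x hx)

theorem notMem_minusOrFlipper {x : Site d} (h : ∃ T : ℝ≥0, ∀ t, T ≤ t → σ t x = 1) :
    x ∉ minusOrFlipper σ := by
  obtain ⟨T, hT⟩ := h
  rintro (⟨T', hT'⟩ | hflip)
  · have h1 := hT (max T T') (le_max_left _ _)
    rw [hT' _ (le_max_right _ _)] at h1
    exact absurd h1 (by decide)
  · obtain ⟨s, t, hs, hst, hne⟩ := hflip T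
    exact hne ((hT t (hs.trans hst)).trans (hT s hs).symm)

end Dynamics

/-! ### Bad blocks of the environment -/

section Environment

variable {d : ℕ}

instance : Inhabited VertexType := ⟨.unfrozen⟩

instance : Finite VertexType :=
  Finite.of_surjective (fun i : Fin 3 => if i = 0 then VertexType.frozenPlus else
    if i = 1 then .frozenMinus else .unfrozen) fun v => by
      cases v
      exacts [⟨0, rfl⟩, ⟨1, rfl⟩, ⟨2, rfl⟩]

instance : DiscreteMeasurableSpace VertexType := ⟨fun _ => trivial⟩

/-- Whether a vertex is frozen plus. -/
def VertexType.isPlus : VertexType → Bool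
  | .frozenPlus => true
  | _ => false

theorem VertexType.isPlus_eq_true {v : VertexType} : v.isPlus = true ↔ v = .frozenPlus := by
  cases v <;> simp [VertexType.isPlus]

/-- The Bernoulli law with parameter `ρ`. -/
noncomputable def bernoulliLaw (ρ : ℝ) : Measure Bool :=
  ENNReal.ofReal ρ • Measure.dirac true + ENNReal.ofReal (1 - ρ) • Measure.dirac false

theorem isProbabilityMeasure_bernoulliLaw {ρ : ℝ} (h0 : 0 ≤ ρ) (h1 : ρ ≤ 1) :
    IsProbabilityMeasure (bernoulliLaw ρ) := by
  constructor
  simp only [bernoulliLaw, Measure.coe_add, Measure.coe_smul, Pi.add_apply, Pi.smul_apply,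
    measure_univ, smul_eq_mul, mul_one]
  rw [← ENNReal.ofReal_add h0 (by linarith)]
  simp

theorem bernoulliLaw_real_true {ρ : ℝ} (h0 : 0 ≤ ρ) : (bernoulliLaw ρ).real {true} = ρ := by
  simp [bernoulliLaw, measureReal_def, h0]

/-- Merging the other two types removes `ρm`, so the block size can be chosen before `ρm`. -/
theorem map_isPlus_vertexLaw {ρp ρm : ℝ} (hm : 0 ≤ ρm) (h : ρp + ρm ≤ 1) :
    (vertexLaw ρp ρm).map VertexType.isPlus = bernoulliLaw ρp := by
  have hmeas : Measurable VertexType.isPlus := .of_discrete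
  rw [vertexLaw, Measure.map_add _ _ hmeas, Measure.map_add _ _ hmeas, Measure.map_smul,
    Measure.map_smul, Measure.map_smul, Measure.map_dirac' hmeas, Measure.map_dirac' hmeas,
    Measure.map_dirac' hmeas, bernoulliLaw, add_assoc]
  simp only [VertexType.isPlus]
  rw [← add_smul, ← ENNReal.ofReal_add hm (by linarith)]
  congr 3; ring

theorem vertexLaw_real_frozenMinus {ρp ρm : ℝ} (hm : 0 ≤ ρm) :
    (vertexLaw ρp ρm).real {.frozenMinus} = ρm := by
  simp [vertexLaw, measureReal_def, hm]

/-- The lowest vertex of the block of side `n` with index `z`. -/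
def blockCorner (n : ℕ) (z : Site d) : Site d := fun i => n * z i

/-- The block with index `z` is bad: there is a frozen minus near it, or no good cube. -/
def badEvent (n : ℕ) (z : Site d) : Set (Environment d) :=
  {η | ∃ x ∈ centeredCube (2 * n) (blockCorner n z), η x = .frozenMinus} ∪
    {η | ¬ HasGoodCube {x | η x = .frozenPlus} n (blockCorner n z)}

theorem preimage_goodCubeEvent (n : ℕ) (c : Site d) :
    (fun (η : Environment d) x => (η x).isPlus) ⁻¹' (goodCubeEvent n c)ᶜ
      = {η | ¬ HasGoodCube {x | η x = .frozenPlus} n c} := by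
  ext η
  simp [goodCubeEvent, VertexType.isPlus_eq_true]

theorem localOn_badEvent (n : ℕ) (z : Site d) :
    LocalOn (centeredCube (2 * n) (blockCorner n z)) (badEvent n z) := by
  refine LocalOn.union ?_ ?_
  · rintro η η' h ⟨x, hx, hm⟩
    exact ⟨x, hx, (h x hx).symm.trans hm⟩
  · rw [← preimage_goodCubeEvent]
    intro η η' h hη
    exact (localOn_goodCubeEvent n _).compl _ _ (fun x hx => by simp only [h x hx]) hη

theorem card_centeredCube (k : ℕ) (c : Site d) : (centeredCube k c).card = (2 * k + 1) ^ d := by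
  rw [centeredCube, cube, Fintype.card_piFinset]
  simp only [side, Finset.mem_univ, if_true, Int.card_Ico, add_sub_cancel_left, Int.toNat_natCast,
    Finset.prod_const, Finset.card_univ, Fintype.card_fin]

/-- The second term does not involve `ρm`; for fixed `n` the first vanishes with `ρm`. -/
theorem measureReal_badEvent_le {ρp ρm : ℝ} (hp : 0 ≤ ρp) (hm : 0 ≤ ρm) (h : ρp + ρm ≤ 1)
    [IsProbabilityMeasure (bernoulliLaw ρp)] (n : ℕ) (z : Site d) :
    (environmentLaw d ρp ρm).real (badEvent n z) ≤ (2 * (2 * n) + 1) ^ d * ρm +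
      (siteLaw d (bernoulliLaw ρp)).real (goodCubeEvent n (blockCorner n z))ᶜ := by
  have := isProbabilityMeasure_vertexLaw hp hm h
  unfold environmentLaw
  refine (measureReal_union_le _ _).trans (add_le_add ?_ ?_)
  · have hsub : {η : Environment d | ∃ x ∈ centeredCube (2 * n) (blockCorner n z),
        η x = .frozenMinus} ⊆ ⋃ x ∈ centeredCube (2 * n) (blockCorner n z),
          {η | ∀ y ∈ ({x} : Finset (Site d)), η y = .frozenMinus} := by
      rintro η ⟨x, hx, hm⟩
      simp only [Set.mem_iUnion]
      exact ⟨x, hx, by simpa using hm⟩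
    refine (measureReal_mono hsub (measure_ne_top _ _)).trans
      ((measureReal_biUnion_finset_le _ _).trans ?_)
    simp only [measureReal_forall_mem_eq, Finset.card_singleton, pow_one,
      vertexLaw_real_frozenMinus hm, Finset.sum_const, card_centeredCube, nsmul_eq_mul]
    push_cast
    rfl
  · have hmeas : Measurable VertexType.isPlus := .of_discrete
    have hmap : (Measure.infinitePi fun _ : Site d => vertexLaw ρp ρm).map
        (fun η x => (η x).isPlus) = siteLaw d (bernoulliLaw ρp) := by
      rw [Measure.infinitePi_map_pi (fun _ : Site d => vertexLaw ρp ρm)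
        (f := fun _ => VertexType.isPlus) fun _ => hmeas]
      simp only [map_isPlus_vertexLaw hm h]
    have hg : Measurable fun (η : Environment d) x => (η x).isPlus :=
      measurable_pi_lambda _ fun x => hmeas.comp (measurable_pi_apply x)
    rw [← hmap, map_measureReal_apply hg (localOn_goodCubeEvent n _).compl.measurableSet,
      preimage_goodCubeEvent]

/-- Distinct indices congruent mod 5 have centers at least `5 * n` apart in some coordinate, more
than the sum `4 * n` of the radii. -/
theorem disjoint_boxes {n : ℕ} (hn : 1 ≤ n) {z z' : Site d} (hne : z ≠ z')
    (h : (fun i => (z i : ZMod 5)) = fun i => (z' i : ZMod 5)) :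
    Disjoint (centeredCube (2 * n) (blockCorner n z)) (centeredCube (2 * n) (blockCorner n z')) := by
  obtain ⟨i, hi⟩ := Function.ne_iff.1 hne
  have h5 : (5 : ℤ) ∣ z' i - z i := by
    have := (ZMod.intCast_eq_intCast_iff_dvd_sub (z i) (z' i) 5).1 (congrFun h i)
    simpa using this
  rw [Finset.disjoint_left]
  intro x hx hx'
  rw [mem_centeredCube] at hx hx'
  have h1 := hx i
  have h2 := hx' i
  have hn' : (1 : ℤ) ≤ n := by exact_mod_cast hn
  simp only [blockCorner] at h1 h2
  push_cast at h1 h2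
  rcases lt_or_gt_of_ne hi with hlt | hlt
  · have : z i + 5 ≤ z' i := by omega
    have := mul_le_mul_of_nonneg_left this (by omega : (0 : ℤ) ≤ n)
    linarith
  · have : z' i + 5 ≤ z i := by omega
    have := mul_le_mul_of_nonneg_left this (by omega : (0 : ℤ) ≤ n)
    linarith

/-- Every vertex of a block is within `n` of its lowest one. This is why good cubes have radius at
least `n`. -/
theorem mem_centeredCube_blockCorner {n k : ℕ} (hn : 1 ≤ n) (hk : n ≤ k) (x : Site d) :
    x ∈ centeredCube k (blockCorner n (blockIndex n x)) := by
  rw [mem_centeredCube]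
  intro i
  have hn' : (0 : ℤ) < n := by exact_mod_cast hn
  have e1 := Int.mul_ediv_self_le (x := x i) hn'.ne'
  have e2 := Int.lt_mul_ediv_self_add (x := x i) hn'
  simp only [blockCorner, blockIndex]
  omega

end Environment

end FrozenMajority

/-! ### Choice of the constants and conclusion -/

theorem theorem3p2 (d : ℕ) (hd : 1 ≤ d) (ρp : ℝ) (hρp : 0 < ρp) :
    ∃ ε : ℝ, 0 < ε ∧ ∀ ρm : ℝ, 0 < ρm → ρm < ε → ρp + ρm ≤ 1 →
      ∀ᵐ ω ∂(law d ρp ρm), ∀ s₀ : Config d,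
        (∃ σ : ℝ≥0 → Config d, IsTrajectory ω s₀ σ) ∧
        ∀ σ : ℝ≥0 → Config d, IsTrajectory ω s₀ σ → ¬ Percolates (minusOrFlipper σ) := by
  by_cases hρ1 : ρp ≤ 1
  swap
  · exact ⟨1, one_pos, fun ρm h0 _ h => absurd (by linarith) hρ1⟩
  have := isProbabilityMeasure_bernoulliLaw hρp.le hρ1
  -- Residues mod 5 serve as the colors, and `δ = 1 / (2 * D)` makes the Peierls ratio `1 / 2`. Half
  -- of `δ` is spent on the absence of a good cube, the other half on the frozen minus vertices.
  set D : ℝ := (2 * d : ℝ) ^ Fintype.card (Fin d → ZMod 5)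
  have hD : 1 ≤ D := by
    refine one_le_pow₀ ?_
    have : (1 : ℝ) ≤ d := by exact_mod_cast hd
    linarith
  set δ : ℝ := 1 / (2 * D)
  have hδ0 : 0 < δ := by positivity
  have hδ1 : δ ≤ 1 := by rw [div_le_one (by positivity)]; linarith
  have hDδ : D * δ < 1 := by
    have : D * δ = 1 / 2 := by simp only [δ]; field_simp
    rw [this]; norm_num
  obtain ⟨n, hn1, hn⟩ := exists_measureReal_compl_goodCubeEvent_le hd (bernoulliLaw ρp)
    (by rw [bernoulliLaw_real_true hρp.le]; exact hρp) (half_pos hδ0)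
  set M : ℝ := (2 * (2 * n) + 1) ^ d
  have hM : 0 < M := by positivity
  refine ⟨δ / 2 / M, by positivity, fun ρm hm0 hm hρ => ?_⟩
  have := isProbabilityMeasure_vertexLaw hρp.le hm0.le hρ
  have : IsProbabilityMeasure (environmentLaw d ρp ρm) := by unfold environmentLaw; infer_instance
  have hbad : ∀ z : Site d, (environmentLaw d ρp ρm).real (badEvent n z) ≤ δ := fun z => by
    have h1 := measureReal_badEvent_le hρp.le hm0.le hρ n z
    have h2 := hn (blockCorner n z)
    have h3 : M * ρm ≤ δ / 2 := by
      rw [mul_comm]; exact ((lt_div_iff₀ hM).1 hm).le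
    linarith
  have hpath := ae_forall_exists_no_bad_path (vertexLaw ρp ρm) (localOn_badEvent n)
    (fun z i => (z i : ZMod 5)) (fun z z' => disjoint_boxes hn1) hδ1 hDδ hd hbad
  have henv : ∀ᵐ ω ∂(law d ρp ρm), ∀ z, ∃ L : ℕ, ∀ l : List (Site d),
      l.IsChain (lattice d).Adj → l.Nodup → l.head? = some z → l.length = L + 1 →
        ¬ ∀ x ∈ l, ω.1 ∈ badEvent n x :=
    Measure.quasiMeasurePreserving_fst.ae hpath
  have hclock : ∀ᵐ ω ∂(law d ρp ρm), ∀ x, RegularWaits (ω.2.1 x) := by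
    have h1 : ∀ᵐ τ ∂(clockLaw d), ∀ x, RegularWaits (τ x) :=
      ae_all_iff.2 fun x => ae_clock_of_ae_waiting x ae_regularWaits
    have h2 : ∀ᵐ ω ∂((clockLaw d).prod (coinLaw d)), ∀ x, RegularWaits (ω.1 x) :=
      Measure.quasiMeasurePreserving_fst.ae h1
    exact Measure.quasiMeasurePreserving_snd.ae h2
  -- Finite sets and natural numbers are countable, so a single null set serves all cubes, all
  -- numbers of rounds and all initial configurations.
  have hwin : ∀ᵐ ω ∂(law d ρp ρm), ∀ (A : Finset (Site d)) (N : ℕ), ∃ R m : ℕ,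
      HeadsWindow A N (m * (N * R)) R ω.2 := by
    have h1 : ∀ᵐ ω ∂((clockLaw d).prod (coinLaw d)), ∀ (A : Finset (Site d)) (N : ℕ),
        ∃ R m : ℕ, HeadsWindow A N (m * (N * R)) R ω :=
      ae_all_iff.2 fun A => ae_all_iff.2 fun N => ae_exists_headsWindow A N
    exact Measure.quasiMeasurePreserving_snd.ae h1
  filter_upwards [henv, hclock, hwin] with ω henv hclock hwin s₀
  refine ⟨exists_isTrajectory ω (fun x => (hclock x).1) (fun x => (hclock x).2) s₀,
    fun σ hσ hperc => ?_⟩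
  -- A vertex of a block that is not bad lies in a cube that is eventually plus, so the component
  -- meets bad blocks only.
  obtain ⟨z, hz⟩ := hperc.exists_path (B := {z | ω.1 ∈ badEvent n z}) hn1 fun x hx => by
    by_contra hgood
    simp only [badEvent, Set.mem_ofPred_eq, Set.mem_union, not_or, not_exists, not_and,
      not_not] at hgood
    obtain ⟨hminus, k, hnk, hk, hcorn, hspan⟩ := hgood
    obtain ⟨T, hT⟩ := hσ.eventually_plus hclock
      (fun y hy => hminus y (centeredCube_mono hk.le _ hy)) hcorn hspan
      (hwin (centeredCube k _))
    exact notMem_minusOrFlipper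
      ⟨T, fun t ht => hT t ht x (mem_centeredCube_blockCorner hn1 hnk x)⟩ hx
  obtain ⟨L, hL⟩ := henv z
  obtain ⟨l, hl1, hl2, hl3, hl4, hl5⟩ := hz L
  exact hL l hl1 hl2 hl3 hl4 hl5
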